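/- Fix a set of proposition symbols and a set of wire symbols. Formulae are $A ::= a \mid \bar a \mid \top \mid \bot \mid A\land A \mid A\lor A$ ($a$ a proposition symbol). Wire variables are $x,\bar x$ for wire symbols $x$. Propositional expansion trees $t$ and witnesses $w$ are given by $$t ::= 1 \mid (w+\dots+w) \mid (t\lor t)\mid (t\lor *)\mid(*\lor t),\qquad w ::= x\mid\bar x\mid t\otimes t,$$ where $(w+\dots+w)$ (an expansion) is a nonempty finite unordered formal sum. They are typed, trees by formulae and witnesses by witness types $[a]$, $[\bar a]$, $A\otimes B$, as follows: $1:\top$; $x:[p]$ and $\bar x:[\bar p]$; if $t:A$ and $s:B$, then $(t\lor s):A\lor B$, $(t\lor *):A\lor B$, $(*\lor s):A\lor B$ and $t\otimes s:A\otimes B$ (for $(t\lor *)$ only $t:A$ is needed and $B$ is arbitrary, and symmetrically for $(*\lor s)$); if all $w_i$ have type $[p]$ (respectively $[\bar p]$, $A\otimes B$), then $(w_1+\dots+w_n)$ has type $p$ (respectively $\bar p$, $A\land B$). An e-annotated sequent is a finite nonempty forest $F$ of typed propositional expansion trees in which each wire variable occurs at most once, $x$ occurs if and only if $\bar x$ occurs,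 and in that case the occurrences of $x$ and $\bar x$ have dual types $[p]$ and $[\bar p]$. The graph of $F$ has as vertices all nodes of the trees of $F$ (including the occurrences of $*$), an edge from each node to its predecessor (parent), and an edge from $x$ to $\bar x$ for each wire symbol $x$ occurring in $F$. A node is switched if it is an expansion or a node $t\lor s$ with neither $t$ nor $s$ equal to $*$. A switching $\sigma$ chooses one successor (child) of each switched node; the switching graph $\sigma(F)$ is obtained from the graph of $F$ by deleting every edge into a switched node other than the one from the chosen successor, and forgetting directions. $F$ is AC-correct if $\sigma(F)$ is acyclic for every switching $\sigma$. The calculus $\mathbf{LK}^*_e$ derives (unordered) sequents by the following rules: axioms $1:\top$ and $(\bar x):\bar p,\ (x):p$; from $F$ and $G$ derive $F,G$ (Mix); from $F,\,t:A,\,s:B$ derive $F,\,(t\lor s):A\lor B$; from $F,\,t:A$ derive $F,\,(t\lor *):A\lor B$; from $F,\,s:B$ derive $F,\,(*\lor s):A\lor B$; from $F,\,t:A$ and $G,\,s:B$ derive $F,\,G,\,(t\otimes s):A\land B$; from $F,\,t:C,\,s:C$, where $C$ is a conjunction $A\land B$ or an atom $p$ or $\bar p$, derive $F,\,t+s:C$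 (contraction). An expansion-net is an e-annotated sequent derivable in $\mathbf{LK}^*_e$. **Theorem (Sequentialization).** Let $F$ be an e-annotated sequent. Then $F$ is an expansion-net (that is, $F$ is derivable in $\mathbf{LK}^*_e$) if and only if $F$ is AC-correct. -/

import Mathlib

namespace ExpansionNets

universe u v

/-- An atom over a set of symbols: a symbol together with a polarity, `true` for `+` and `false`
for `-`. -/
abbrev Atom (P : Type u) : Type u := P × Bool

/-- Formulae of classical propositional logic (in negation normal form) over the proposition
symbols `P`. -/
inductive Formula (P : Type u) : Type u
  | atom (a : Atom P) : Formula P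
  | top : Formula P
  | bot : Formula P
  | and (A B : Formula P) : Formula P
  | or (A B : Formula P) : Formula P

/-- Types: formulae, the atomic witness types `[a]` (positive or negative, according to the
polarity of `a`), and the conjunctive witness types `A ⊗ B`. -/
inductive Typ (P : Type u) : Type u
  | form (A : Formula P) : Typ P
  | wAtom (a : Atom P) : Typ P
  | wTensor (A B : Formula P) : Typ P

/-- Raw terms, from which propositional expansion trees and witnesses over the wire symbols `X`
are singled out by the typing rules below. A wire variable is an atom over `X`. A formal sum is
represented by a list of its members; nothing below depends on the order in which the members are
listed. `star` is the symbol `*`, which has no type and is only allowed as one of the two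
immediate subterms of a default weakening `(t ∨ *)` or `(* ∨ t)`. -/
inductive Term (X : Type v) : Type v
  | one : Term X
  | star : Term X
  | var (x : Atom X) : Term X
  | sum (ws : List (Term X)) : Term X
  | or (t s : Term X) : Term X
  | tensor (t s : Term X) : Term X

/-- The typing system. The partial function `τ` records which proposition symbol is assigned to
which wire symbol, so that `x` receives the type `[p]` and `x̄` the dual type `[p̄]`, for the
same `p = τ x`. The terms with a formula as type are propositional expansion trees, the terms with
a witness type are witnesses. -/
inductive HasType {P : Type u} {X : Type v} (τ : X → Option P) : Term X → Typ P → Prop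
  | one : HasType τ Term.one (Typ.form Formula.top)
  | var (x : X) (i : Bool) (p : P) (h : τ x = some p) :
      HasType τ (Term.var (x, i)) (Typ.wAtom (p, i))
  | or (t s : Term X) (A B : Formula P) (ht : HasType τ t (Typ.form A))
      (hs : HasType τ s (Typ.form B)) :
      HasType τ (Term.or t s) (Typ.form (Formula.or A B))
  | orStar (t : Term X) (A B : Formula P) (ht : HasType τ t (Typ.form A)) :
      HasType τ (Term.or t Term.star) (Typ.form (Formula.or A B))
  | starOr (s : Term X) (A B : Formula P) (hs : HasType τ s (Typ.form B)) :
      HasType τ (Term.or Term.star s) (Typ.form (Formula.or A B))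
  | tensor (t s : Term X) (A B : Formula P) (ht : HasType τ t (Typ.form A))
      (hs : HasType τ s (Typ.form B)) :
      HasType τ (Term.tensor t s) (Typ.wTensor A B)
  | sumAtom (ws : List (Term X)) (a : Atom P) (hne : ws ≠ [])
      (h : ∀ w ∈ ws, HasType τ w (Typ.wAtom a)) :
      HasType τ (Term.sum ws) (Typ.form (Formula.atom a))
  | sumAnd (ws : List (Term X)) (A B : Formula P) (hne : ws ≠ [])
      (h : ∀ w ∈ ws, HasType τ w (Typ.wTensor A B)) :
      HasType τ (Term.sum ws) (Typ.form (Formula.and A B))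

/-- A finite list of roots, each a term with a type. -/
abbrev Forest (P : Type u) (X : Type v) : Type (max u v) := List (Term X × Typ P)

/-! ### Nodes -/

/-- The immediate subterms of a term, including `*`. -/
def Term.children {X : Type v} : Term X → List (Term X)
  | Term.one => []
  | Term.star => []
  | Term.var _ => []
  | Term.sum ws => ws
  | Term.or t s => [t, s]
  | Term.tensor t s => [t, s]

/-- The subterm of a term at an address, if there is one: the address lists, from the root up,
which immediate subterm to take. -/
def Term.sub {X : Type v} : Term X → List ℕ → Option (Term X)
  | t, [] => some t
  | t, k :: p => t.children[k]?.bind fun s => s.sub p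

/-- The subterm of a forest at the address `(i, p)`: the subterm at `p` of the `i`-th root. -/
def Forest.termAt {P : Type u} {X : Type v} (F : Forest P X) (a : ℕ × List ℕ) :
    Option (Term X) :=
  F[a.1]?.bind fun r => r.1.sub a.2

/-- The nodes of a forest: the occurrences of subterms in it (including the occurrences of
`*`). -/
abbrev Forest.Node {P : Type u} {X : Type v} (F : Forest P X) : Type :=
  {a : ℕ × List ℕ // (F.termAt a).isSome}

/-- The subterm rooted at a node. -/
def Forest.Node.term {P : Type u} {X : Type v} {F : Forest P X} (a : F.Node) : Term X :=
  (F.termAt a.1).get a.2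

/-- `a.IsSucc b`: the node `b` is a successor of the node `a`, that is, `a` is the predecessor
of `b`. -/
def Forest.Node.IsSucc {P : Type u} {X : Type v} {F : Forest P X} (a b : F.Node) : Prop :=
  ∃ k : ℕ, b.1 = (a.1.1, a.1.2 ++ [k])

/-! ### Typed forests and annotated sequents -/

/-- Typed forests: every root is typed, every wire variable occurs at most once, a wire variable
occurs if and only if its dual occurs, and dual occurrences have dual types (all roots being typed
with the same `τ`). -/
structure Forest.IsTyped {P : Type u} {X : Type v} (F : Forest P X) : Prop where
  typed : ∃ τ : X → Option P, ∀ r ∈ F, HasType τ r.1 r.2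
  linear : ∀ (x : Atom X) (a b : F.Node), a.term = Term.var x → b.term = Term.var x → a = b
  paired : ∀ x : X, (∃ a : F.Node, a.term = Term.var (x, true)) ↔
    (∃ a : F.Node, a.term = Term.var (x, false))

/-- An e-annotated sequent: a typed forest all of whose roots are expansion trees, that is, typed
with formulae. -/
structure Forest.IsEAnnotatedSequent {P : Type u} {X : Type v} (F : Forest P X) : Prop
    extends F.IsTyped where
  formulas : ∀ r ∈ F, ∃ A : Formula P, r.2 = Typ.form A

/-! ### The graph and AC-correctness -/

/-- The directed edges of the graph of a forest: from each node to its predecessor, and from `x`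
to `x̄` for each wire symbol `x`. -/
def Forest.Edge {P : Type u} {X : Type v} (F : Forest P X) (a b : F.Node) : Prop :=
  b.IsSucc a ∨ ∃ x : X, a.term = Term.var (x, true) ∧ b.term = Term.var (x, false)

/-- Terms whose root is switched: expansions, and disjunctions that are not default
weakenings. -/
def Term.IsSwitched {X : Type v} : Term X → Prop
  | Term.sum _ => True
  | Term.or t s => t ≠ Term.star ∧ s ≠ Term.star
  | _ => False

/-- A switching: a choice of a successor for each switched node. -/
structure Forest.Switching {P : Type u} {X : Type v} (F : Forest P X) where
  choice : (a : F.Node) → a.term.IsSwitched → F.Node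
  isSucc : ∀ (a : F.Node) (h : a.term.IsSwitched), a.IsSucc (choice a h)

/-- The switching graph: delete from the graph of the forest all edges into a switched node other
than the one coming from the successor chosen, and forget the directions. -/
def Forest.Switching.graph {P : Type u} {X : Type v} {F : Forest P X} (σ : F.Switching) :
    SimpleGraph F.Node :=
  SimpleGraph.fromRel fun a b =>
    F.Edge a b ∧ ∀ h : b.term.IsSwitched, a = σ.choice b h

/-- AC-correctness: every switching graph is acyclic. -/
def Forest.ACCorrect {P : Type u} {X : Type v} (F : Forest P X) : Prop :=
  ∀ σ : F.Switching, σ.graph.IsAcyclic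

/-! ### The annotated sequent calculus -/

/-- Derivability in the annotated calculus `LK*_e`. Sequents have no order: `exch` reorders the
roots. In the contraction rules, `us` is any listing of the formal sum of `ws` and `vs`. -/
inductive Derivable {P : Type u} {X : Type v} : Forest P X → Prop
  | exch (F G : Forest P X) (h : F.Perm G) (d : Derivable F) : Derivable G
  | axTop : Derivable [(Term.one, Typ.form Formula.top)]
  | ax (x : X) (p : P) :
      Derivable [(Term.sum [Term.var (x, false)], Typ.form (Formula.atom (p, false))),
        (Term.sum [Term.var (x, true)], Typ.form (Formula.atom (p, true)))]
  | mix (F G : Forest P X) (d : Derivable F) (e : Derivable G) : Derivable (F ++ G)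
  | or (F : Forest P X) (t s : Term X) (A B : Formula P)
      (d : Derivable ((t, Typ.form A) :: (s, Typ.form B) :: F)) :
      Derivable ((Term.or t s, Typ.form (Formula.or A B)) :: F)
  | or₀ (F : Forest P X) (t : Term X) (A B : Formula P)
      (d : Derivable ((t, Typ.form A) :: F)) :
      Derivable ((Term.or t Term.star, Typ.form (Formula.or A B)) :: F)
  | or₁ (F : Forest P X) (s : Term X) (A B : Formula P)
      (d : Derivable ((s, Typ.form B) :: F)) :
      Derivable ((Term.or Term.star s, Typ.form (Formula.or A B)) :: F)
  | and (F G : Forest P X) (t s : Term X) (A B : Formula P)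
      (d : Derivable ((t, Typ.form A) :: F)) (e : Derivable ((s, Typ.form B) :: G)) :
      Derivable ((Term.sum [Term.tensor t s], Typ.form (Formula.and A B)) :: (F ++ G))
  | contrAnd (F : Forest P X) (ws vs us : List (Term X)) (A B : Formula P)
      (h : us.Perm (ws ++ vs))
      (d : Derivable ((Term.sum ws, Typ.form (Formula.and A B)) ::
        (Term.sum vs, Typ.form (Formula.and A B)) :: F)) :
      Derivable ((Term.sum us, Typ.form (Formula.and A B)) :: F)
  | contrAtom (F : Forest P X) (ws vs us : List (Term X)) (a : Atom P)
      (h : us.Perm (ws ++ vs))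
      (d : Derivable ((Term.sum ws, Typ.form (Formula.atom a)) ::
        (Term.sum vs, Typ.form (Formula.atom a)) :: F)) :
      Derivable ((Term.sum us, Typ.form (Formula.atom a)) :: F)

/-- An expansion-net: an e-annotated sequent derivable in `LK*_e`. -/
def Forest.IsExpansionNet {P : Type u} {X : Type v} (F : Forest P X) : Prop :=
  F.IsEAnnotatedSequent ∧ Derivable F

end ExpansionNets

/-!
AC-correctness is first restated without switchings. Give all edges from the successors of a switched
node the same colour at that node, and all other pairs of edges at a node distinct colours. Two
consecutive edges of a path form a *cusp* if they have the same colour at the node between them. A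
cycle is contained in some switching graph exactly if it has no cusp, so a typed forest is AC-correct
if and only if it has no cusp-free cycle (`Forest.acCorrect_of_noCycle`, `Forest.ACCorrect.noCycle`).

Both directions are proved inside the one fixed forest `F`, by speaking of the sub-forests spanned by
lists of nodes with disjoint subtrees. An expansion at the root is replaced by its members, and a
witness `w` at the root stands for the expansion `(w)`. In this way contraction and its inverse
change nothing, and the absence of cusp-free cycles passes to all sub-forests.

Soundness (`Derivable.isNet`) is an induction on the derivation. Each rule adds a node whose edges
into any one of the premises have the same colour, and the premises are not joined by an edge, since
each is closed under duality of wire variables; a cusp-free cycle cannot pass through such a node.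

Sequentialization (`Forest.IsTypedList.derivable`) is an induction on the size of the sub-forest.
Roots which are trees are decomposed by the inverse of the rule for their outermost constructor, and
axioms are split off. If only wire variables and tensors are left, there is a root tensor whose two
successors are connected only through it, and the other roots can be distributed over the two
successors accordingly.

This splitting tensor comes from a form of Yeo's theorem on edge-coloured graphs
(`CuspGraph.NoCycle.exists_splitting`). Consider cusp-free paths which end with a step down the
forest and to which no cusp-free continuation can return, and take a longest one. It ends at a root
`c`, since otherwise one could step further down. If it arrived at `c` from the successor `t` and the
other successor `s` were connected to `t` without `c`, then on the way from `s` to `t` one would meet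
the first vertex not reachable from `c` by a cusp-free path leaving through `s`. There the
obstruction is a cusp, and the path which leads to that cusp admits no return either: a returning
path would either close a cusp-free cycle or reach the cusp from its other side. So the longest path
could be prolonged.
-/

namespace ExpansionNets

/-! ### Cusp-free paths and splitting -/

/-- A graph with a local colouring of its edges: `Cusp v a b` says that the edges joining `v` to `a`
and to `b` have the same colour at `v`, so that a path may not traverse both of them in a row. In
particular a path may not turn back along the edge it came by, since `Cusp v` is reflexive. -/
structure CuspGraph (V : Type*) where
  Adj : V → V → Prop
  symm : ∀ {a b}, Adj a b → Adj b a
  Cusp : V → V → V → Prop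
  equiv : ∀ v, Equivalence (Cusp v)

namespace CuspGraph

variable {V : Type*} (G : CuspGraph V)

/-- The list of vertices is a walk in which no two consecutive edges form a cusp. -/
def CuspFree : List V → Prop
  | a :: b :: c :: l => G.Adj a b ∧ ¬ G.Cusp b a c ∧ CuspFree (b :: c :: l)
  | [a, b] => G.Adj a b
  | _ => True

/-- The list of vertices is a cycle without cusps. Its first two vertices are repeated at the end,
so that the cusps at all vertices of the cycle are taken into account. Such a cycle has at least
three vertices, because a cusp-free walk does not turn back. -/
def IsCycle : List V → Prop
  | a :: b :: l => (a :: b :: l).Nodup ∧ G.CuspFree (a :: b :: (l ++ [a, b]))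
  | _ => False

/-- There is no cusp-free cycle within `U`. -/
def NoCycle (U : Set V) : Prop := ∀ L, G.IsCycle L → ¬ ∀ v ∈ L, v ∈ U

variable {G}

lemma CuspFree.tail {a : V} {l : List V} (h : G.CuspFree (a :: l)) : G.CuspFree l := by
  match l, h with
  | [], _ => trivial
  | [_], _ => trivial
  | _ :: _ :: _, h => exact h.2.2

lemma CuspFree.adj {a b : V} {l : List V} (h : G.CuspFree (a :: b :: l)) : G.Adj a b := by
  match l, h with
  | [], h => exact h
  | _ :: _, h => exact h.1

variable (G) in
/-- The subgraph induced on `U`. -/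
def induce (U : Set V) : CuspGraph V where
  Adj a b := G.Adj a b ∧ a ∈ U ∧ b ∈ U
  symm h := ⟨G.symm h.1, h.2.2, h.2.1⟩
  Cusp := G.Cusp
  equiv := G.equiv

lemma CuspFree.of_induce {U : Set V} {l : List V} (h : (G.induce U).CuspFree l) :
    G.CuspFree l := by
  induction l with
  | nil => trivial
  | cons a l ih =>
    match l, h, ih with
    | [], _, _ => trivial
    | [_], h, _ => exact h.1
    | _ :: _ :: _, h, ih => exact ⟨h.1.1, h.2.1, ih h.2.2⟩

lemma NoCycle.induce (h : G.NoCycle Set.univ) (U : Set V) : (G.induce U).NoCycle Set.univ := by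
  intro L hL _
  match L, hL with
  | a :: b :: l, hL => exact h (a :: b :: l) ⟨hL.1, hL.2.of_induce⟩ (by simp)

lemma CuspFree.right {l m : List V} (h : G.CuspFree (l ++ m)) : G.CuspFree m := by
  induction l with
  | nil => exact h
  | cons a l ih => exact ih h.tail

/-- Two cusp-free walks that overlap in an edge can be glued along it. -/
lemma CuspFree.glue {l m : List V} {x y : V} (h : G.CuspFree (l ++ [x, y]))
    (h' : G.CuspFree (x :: y :: m)) : G.CuspFree (l ++ x :: y :: m) := by
  induction l with
  | nil => exact h'
  | cons a l ih =>
    match l, h, ih with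
    | [], h, _ => exact ⟨h.1, h.2.1, h'⟩
    | [b], h, ih => exact ⟨h.1, h.2.1, ih h.2.2⟩
    | b :: c :: l, h, ih => exact ⟨h.1, h.2.1, ih h.2.2⟩

lemma CuspFree.reverse {l : List V} (h : G.CuspFree l) : G.CuspFree l.reverse := by
  induction l with
  | nil => trivial
  | cons a l ih =>
    match l, h, ih with
    | [], _, _ => trivial
    | [b], h, _ => exact G.symm h
    | b :: c :: l, h, ih =>
      have h1 : G.CuspFree (l.reverse ++ [c, b]) := by simpa using ih h.tail
      have h2 : G.CuspFree [c, b, a] :=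
        ⟨G.symm h.2.2.adj, fun hc => h.2.1 ((G.equiv b).symm hc), G.symm h.1⟩
      simpa using h1.glue h2

lemma CuspFree.left {l m : List V} (h : G.CuspFree (l ++ m)) : G.CuspFree l := by
  have h1 := h.reverse
  rw [List.reverse_append] at h1
  simpa using h1.right.reverse

/-- Gluing two cusp-free walks at a vertex where they do not form a cusp. -/
lemma CuspFree.join {l m : List V} {a x b : V} (h : G.CuspFree (l ++ [a, x]))
    (h' : G.CuspFree (x :: b :: m)) (hc : ¬ G.Cusp x a b) :
    G.CuspFree (l ++ a :: x :: b :: m) :=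
  h.glue ⟨(h.right : G.CuspFree [a, x]), hc, h'⟩

lemma IsCycle.rotate_one {a : V} {l : List V} (h : G.IsCycle (a :: l)) :
    G.IsCycle (l ++ [a]) := by
  match l, h with
  | [b], h => exact (h.2.2.1 ((G.equiv b).refl a)).elim
  | b :: c :: l, h =>
    obtain ⟨h1, h2⟩ := h
    refine ⟨?_, ?_⟩
    · have : (a :: b :: c :: l).Perm (b :: c :: (l ++ [a])) :=
        (List.perm_append_comm (l₁ := [a]) (l₂ := b :: c :: l))
      exact this.nodup_iff.1 h1
    · have h3 : G.CuspFree ((b :: c :: l) ++ [a, b]) := h2.tail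
      have h4 : G.CuspFree [a, b, c] := ⟨h2.1, h2.2.1, h2.2.2.adj⟩
      simpa using h3.glue h4

/-- A cusp-free cycle can be listed from any of its vertices. -/
lemma IsCycle.exists_head {L : List V} (h : G.IsCycle L) {n : V} (hn : n ∈ L) :
    ∃ M, G.IsCycle (n :: M) ∧ (n :: M).Perm L := by
  obtain ⟨l, m, rfl⟩ := List.append_of_mem hn
  clear hn
  induction l generalizing m with
  | nil => exact ⟨m, h, List.Perm.refl _⟩
  | cons a l ih =>
    have h1 := IsCycle.rotate_one (l := l ++ n :: m) h
    rw [List.append_assoc] at h1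
    obtain ⟨M, hM, hp⟩ := ih (m ++ [a]) h1
    refine ⟨M, hM, hp.trans ?_⟩
    have := (List.perm_append_comm (l₁ := [a]) (l₂ := l ++ n :: m)).symm
    simpa using this

lemma CuspFree.getElem {l : List V} (h : G.CuspFree l) {i : ℕ} {a b c : V}
    (ha : l[i]? = some a) (hb : l[i + 1]? = some b) (hc : l[i + 2]? = some c) :
    G.Adj a b ∧ ¬ G.Cusp b a c := by
  have hi : i + 2 < l.length := by
    by_contra hi
    rw [List.getElem?_eq_none (by omega)] at hc
    cases hc
  have e : l = l.take i ++ a :: b :: c :: l.drop (i + 3) := by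
    rw [List.getElem?_eq_getElem (by omega)] at ha hb hc
    rw [← Option.some.inj ha, ← Option.some.inj hb, ← Option.some.inj hc,
      ← List.drop_eq_getElem_cons, ← List.drop_eq_getElem_cons, ← List.drop_eq_getElem_cons,
      List.take_append_drop]
  rw [e] at h
  exact ⟨h.right.1, h.right.2.1⟩

/-- A cusp-free cycle, indexed cyclically. -/
lemma IsCycle.exists_enum {L : List V} (h : G.IsCycle L) :
    ∃ (n : ℕ) (f : Fin (n + 3) → V), Function.Injective f ∧
      ∀ i, G.Adj (f i) (f (i + 1)) ∧ ¬ G.Cusp (f (i + 1)) (f i) (f (i + 1 + 1)) := by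
  match L, h with
  | [a, b], h => exact (h.2.2.1 ((G.equiv b).refl a)).elim
  | a :: b :: c :: l, h =>
    obtain ⟨hn, hc⟩ := h
    let L := a :: b :: c :: l
    have hL : L.length = l.length + 3 := rfl
    have hlast : ∀ (k : ℕ) (j : Fin (l.length + 3)), k < l.length + 5 →
        j.1 = k % (l.length + 3) → (L ++ [a, b])[k]? = some (L[j.1]'(by omega)) := by
      intro k j hk hj
      rcases lt_or_ge k (l.length + 3) with h | h
      · rw [List.getElem?_append_left (by omega), List.getElem?_eq_getElem (by omega)]
        simp only [hj, Nat.mod_eq_of_lt h]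
      · rw [List.getElem?_append_right (by omega)]
        rw [Nat.mod_eq_sub_mod h, Nat.mod_eq_of_lt (by omega)] at hj
        obtain h | h : k = l.length + 3 ∨ k = l.length + 4 := by omega
        · subst h
          simp only [Nat.sub_self] at hj
          simp [hj, hL, L]
        · subst h
          have : j.1 = 1 := by omega
          simp [this, hL, L]
    refine ⟨l.length, fun i => L[i.1]'(by omega), fun i j hij => ?_, fun i => ?_⟩
    · exact Fin.ext ((List.Nodup.getElem_inj_iff hn).1 hij)
    · have e1 : (i + 1).1 = (i.1 + 1) % (l.length + 3) := by simp [Fin.val_add]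
      have e2 : (i + 1 + 1).1 = (i.1 + 2) % (l.length + 3) := by
        rw [Fin.val_add, e1]; exact Nat.mod_add_mod _ _ _
      exact hc.getElem (hlast i.1 i (by omega) (Nat.mod_eq_of_lt i.2).symm)
        (hlast (i.1 + 1) (i + 1) (by omega) e1) (hlast (i.1 + 2) (i + 1 + 1) (by omega) e2)

/-- A cusp-free walk from `x` to `x` whose two ends do not form a cusp is a cusp-free cycle. -/
lemma NoCycle.closed {x g f : V} {l l₁ l₂ : List V} (hG : G.NoCycle Set.univ)
    (hn : (x :: l).Nodup) (hl : G.CuspFree (x :: (l ++ [x]))) (h₁ : l = g :: l₁)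
    (h₂ : l = l₂ ++ [f]) : G.Cusp x g f := by
  by_contra hc
  subst h₁
  refine hG (x :: g :: l₁) ⟨hn, ?_⟩ (by simp)
  have h3 : G.CuspFree ((x :: l₂) ++ [f, x]) := by
    rw [h₂] at hl
    simpa using hl
  have h4 : G.CuspFree [f, x, g] :=
    ⟨(h3.right : G.CuspFree [f, x]), fun h => hc ((G.equiv x).symm h), hl.adj⟩
  have h5 := h3.glue h4
  have : (x :: l₂) ++ [f, x, g] = x :: ((l₂ ++ [f]) ++ [x, g]) := by simp
  rw [this, ← h₂] at h5
  exact h5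

variable (G) in
/-- No cusp-free path that continues the edge from `b` to `c` beyond `c` reaches `q`. Here and
below, paths are listed from their last vertex to their first. -/
def NoReturn (c b : V) (q : List V) : Prop :=
  ∀ x r, G.CuspFree (x :: (r ++ [c, b])) → (x :: (r ++ [c])).Nodup → x ∉ q

variable (G) in
/-- The cusp-free path which ends with the edge from `b` to `c`, and before that runs through `p`,
cannot be continued to a cusp-free walk that meets it again. -/
structure Good (c b : V) (p : List V) : Prop where
  cuspFree : G.CuspFree (c :: b :: p)
  nodup : (c :: b :: p).Nodup
  noReturn : G.NoReturn c b (b :: p)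

lemma NoReturn.disjoint {c b : V} {q r : List V} (h : G.NoReturn c b q)
    (hr : G.CuspFree (r ++ [c, b])) (hn : (r ++ [c]).Nodup) : ∀ x ∈ r, x ∉ q := by
  intro x hx
  obtain ⟨l, m, rfl⟩ := List.append_of_mem hx
  refine h x m ?_ ?_
  · rw [List.append_assoc] at hr
    exact hr.right
  · rw [List.append_assoc] at hn
    exact hn.of_append_right

/-- Prolonging a good path by a path that admits no return to itself yields a good path. -/
lemma Good.extend {c b d e : V} {p q q' : List V} (hp : G.Good c b p) (hq : e :: q' = q ++ [c])
    (h₁ : G.CuspFree (d :: (q ++ [c, b]))) (h₂ : (d :: (q ++ [c])).Nodup)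
    (h₃ : G.NoReturn d e (q ++ [c])) : G.Good d e (q' ++ b :: p) := by
  have e₀ : e :: (q' ++ b :: p) = q ++ c :: b :: p := by
    rw [← List.cons_append, hq]; simp
  have e₁ : e :: (q' ++ [b]) = q ++ [c, b] := by
    rw [← List.cons_append, hq]; simp
  have hd := hp.noReturn.disjoint (r := d :: q) h₁ h₂
  refine ⟨?_, ?_, ?_⟩
  · rw [e₀]
    exact CuspFree.glue (l := d :: q) h₁ hp.cuspFree
  · rw [e₀]
    have : d :: (q ++ c :: b :: p) = (d :: (q ++ [c])) ++ b :: p := by simp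
    rw [this, List.nodup_append]
    refine ⟨h₂, hp.nodup.tail, ?_⟩
    rintro x hx y hy rfl
    have hx' : x ∈ (d :: q) ∨ x = c := by simpa [or_assoc] using hx
    rcases hx' with hx' | rfl
    · exact hd x hx' hy
    · exact (List.nodup_cons.1 hp.nodup).1 hy
  · intro x r hx hn hm
    have hr := h₃.disjoint (r := x :: r) hx hn
    rw [e₀] at hm
    have hm' : x ∈ q ++ [c] ∨ x ∈ b :: p := by
      simp only [List.mem_append, List.mem_cons, List.not_mem_nil, or_false] at hm ⊢
      tauto
    rcases hm' with hm' | hm'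
    · exact hr x (by simp) hm'
    · refine hp.noReturn x (r ++ d :: q) ?_ ?_ hm'
      · have : x :: (r ++ d :: q ++ [c, b]) = (x :: r) ++ d :: e :: (q' ++ [b]) := by
          rw [e₁]; simp
        rw [this]
        exact CuspFree.glue (l := x :: r) hx (by rw [e₁]; exact h₁)
      · have : x :: (r ++ d :: q ++ [c]) = (x :: r) ++ d :: (q ++ [c]) := by simp
        rw [this, List.nodup_append]
        refine ⟨(List.nodup_append.1 (show ((x :: r) ++ [d]).Nodup from hn)).1, h₂, ?_⟩
        rintro y hy z hz rfl
        rcases List.mem_cons.1 hz with rfl | hz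
        · exact (List.nodup_append.1 (show ((x :: r) ++ [y]).Nodup from hn)).2.2 y hy y
            (by simp) rfl
        · exact hr y hy hz

/-- If the edge from `c` to `d` forms no cusp at `c`, then no cusp-free path continuing it comes
back to `c`. -/
lemma NoCycle.noReturn_edge (hG : G.NoCycle Set.univ) {c d : V}
    (hc : ∀ e, G.Cusp c e d → e = d) : G.NoReturn d c [c] := by
  intro x r hx hn hm
  obtain rfl : x = c := by simpa using hm
  match r, hx, hn with
  | [], hx, _ => exact hx.2.1 ((G.equiv d).refl x)
  | f :: r, hx, hn =>
    have hx' : G.CuspFree (x :: ((f :: r ++ [d]) ++ [x])) := by simpa using hx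
    obtain rfl := hc f (hG.closed hn hx' rfl rfl)
    simp at hn

/-- The core of the splitting theorem. Suppose that `t` is reachable from a neighbour `s` of `v`
without passing through `v`. Somewhere on the way from `s` to `t` the vertices cease to be reachable
by cusp-free paths which leave `v` by another colour than that of `t`. This happens at a cusp, and
the path leading to that cusp admits no return. -/
lemma NoCycle.exists_noReturn (hG : G.NoCycle Set.univ) {v t s : V} (hvt : G.Adj v t)
    (ht : ∀ e, G.Cusp t e v → e = v) (hvs : G.Adj v s) (hsv : s ≠ v) (hst : ¬ G.Cusp v s t)
    (hconn : Relation.ReflTransGen (fun a b => G.Adj a b ∧ b ≠ v) s t) :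
    ∃ d e q q' z, e :: q' = q ++ [v] ∧ G.CuspFree (d :: (q ++ [v, t])) ∧
      (d :: (q ++ [v])).Nodup ∧ G.NoReturn d e (q ++ [v]) ∧ G.Cusp d e z ∧ e ≠ z := by
  let R : V → Prop := fun z => ∃ q, G.CuspFree (z :: (q ++ [v, t])) ∧ (z :: (q ++ [v])).Nodup
  have hR : ∀ {q : List V}, G.CuspFree (q ++ [v, t]) → (q ++ [v]).Nodup → ∀ z ∈ q, R z := by
    intro q h1 h2 z hz
    obtain ⟨l, m, rfl⟩ := List.append_of_mem hz
    rw [List.append_assoc] at h1 h2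
    exact ⟨m, h1.right, h2.of_append_right⟩
  have hRs : R s := ⟨[], ⟨G.symm hvs, hst, hvt⟩, by simpa using hsv⟩
  have hRt : ¬ R t := fun ⟨q, h1, h2⟩ => hG.noReturn_edge ht t q h1 h2 (by simp)
  obtain ⟨c, z, hc, hz, hcz, hzv⟩ : ∃ c z, R c ∧ ¬ R z ∧ G.Adj c z ∧ z ≠ v := by
    by_contra! hcon
    have hall : ∀ w, Relation.ReflTransGen (fun a b => G.Adj a b ∧ b ≠ v) s w → R w := by
      intro w hw
      induction hw with
      | refl => exact hRs
      | tail _ h ih => by_contra hz; exact h.2 (hcon _ _ ih hz h.1)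
    exact hRt (hall t hconn)
  -- A cusp-free path to `c` can be prolonged to `z` unless its last edge forms a cusp with that to
  -- `z`.
  have key : ∀ {q q' : List V} {e : V}, e :: q' = q ++ [v] → G.CuspFree (c :: (q ++ [v, t])) →
      (c :: (q ++ [v])).Nodup → G.Cusp c e z := by
    intro q q' e he h1 h2
    by_contra hcusp
    have e₁ : e :: (q' ++ [t]) = q ++ [v, t] := by
      rw [← List.cons_append, he]; simp
    refine hz ⟨c :: q, ?_, ?_⟩
    · show G.CuspFree (z :: c :: (q ++ [v, t]))
      rw [← e₁] at h1 ⊢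
      exact ⟨G.symm hcz, fun h => hcusp ((G.equiv c).symm h), h1⟩
    · refine List.nodup_cons.2 ⟨fun hm => ?_, h2⟩
      have hm' : z ∈ (c :: q) ∨ z = v := by simpa [or_assoc] using hm
      exact hm'.elim (fun hm' => hz (hR (q := c :: q) h1 h2 z hm')) hzv
  obtain ⟨q, h1, h2⟩ := hc
  obtain ⟨e, q', he⟩ : ∃ e q', e :: q' = q ++ [v] := by
    cases q with
    | nil => exact ⟨v, [], rfl⟩
    | cons a q => exact ⟨a, _, rfl⟩
  have e₁ : e :: (q' ++ [t]) = q ++ [v, t] := by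
    rw [← List.cons_append, he]; simp
  refine ⟨c, e, q, q', z, he, h1, h2, ?_, key he h1 h2, ?_⟩
  · -- By induction on the length, a returning path meets the given one in its last vertex only.
    suffices H : ∀ n r x, r.length = n → G.CuspFree (x :: (r ++ [c, e])) →
        (x :: (r ++ [c])).Nodup → x ∉ q ++ [v] from fun x r => H _ r x rfl
    intro n
    induction n using Nat.strong_induction_on with
    | _ n ih =>
    intro r x hrn hx hn hm
    have hr : ∀ y ∈ r, y ∉ q ++ [v] := by
      intro y hy
      obtain ⟨l, m, rfl⟩ := List.append_of_mem hy
      refine ih m.length (by subst hrn; simp; omega) m y rfl ?_ ?_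
      · have : x :: (l ++ y :: m ++ [c, e]) = (x :: l) ++ y :: (m ++ [c, e]) := by simp
        rw [this] at hx
        exact hx.right
      · have : x :: (l ++ y :: m ++ [c]) = (x :: l) ++ y :: (m ++ [c]) := by simp
        rw [this] at hn
        exact hn.of_append_right
    -- The path to `c` is `c, A, x, B` (backwards), and continues from `x` to `y`.
    obtain ⟨A, B, hAB⟩ := List.append_of_mem hm
    obtain ⟨y, B', hB⟩ : ∃ y B', y :: B' = B ++ [t] := by
      cases B with
      | nil => exact ⟨t, [], rfl⟩
      | cons a B => exact ⟨a, _, rfl⟩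
    obtain ⟨f, A', hA⟩ : ∃ f A', c :: A = A' ++ [f] :=
      ⟨_, _, (List.dropLast_append_getLast (List.cons_ne_nil c A)).symm⟩
    obtain ⟨g, r', hg⟩ : ∃ g r', r ++ [c] = g :: r' := by
      cases r with
      | nil => exact ⟨c, [], rfl⟩
      | cons a r => exact ⟨a, _, rfl⟩
    have e₂ : c :: (q ++ [v, t]) = A' ++ f :: x :: y :: B' := by
      have h : c :: (q ++ [v, t]) = (c :: (q ++ [v])) ++ [t] := by simp
      rw [h, hAB, hB]
      have h' : c :: (A ++ x :: B) ++ [t] = (c :: A) ++ x :: (B ++ [t]) := by simp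
      rw [h', hA]
      simp
    have hfy : ¬ G.Cusp x f y := by
      have h1' := h1
      rw [e₂] at h1'
      exact h1'.right.2.1
    have hxr : G.CuspFree (x :: (r ++ [c])) := by
      have : x :: (r ++ [c, e]) = (x :: (r ++ [c])) ++ [e] := by simp
      rw [this] at hx
      exact hx.left
    have hnAB : (c :: A ++ x :: B).Nodup := by
      have := h2
      rwa [hAB] at this
    have hnr : (x :: r).Nodup := (List.nodup_append.1 (show ((x :: r) ++ [c]).Nodup from hn)).1
    by_cases hgy : G.Cusp x g y
    · -- The part of the path from `x` to `c` and the returning path form a cycle.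
      have hcyc : G.Cusp x g f := by
        refine hG.closed (l := r ++ c :: A) (l₁ := r' ++ A) (l₂ := r ++ A') ?_ ?_ ?_ ?_
        · have : x :: (r ++ c :: A) = (x :: r) ++ c :: A := rfl
          rw [this, List.nodup_append]
          refine ⟨hnr, (List.nodup_append.1 hnAB).1, ?_⟩
          rintro a ha b hb rfl
          rcases List.mem_cons.1 hb with rfl | hb
          · exact (List.nodup_append.1 (show ((x :: r) ++ [a]).Nodup from hn)).2.2 a ha a
              (by simp) rfl
          · rcases List.mem_cons.1 ha with rfl | ha
            · exact (List.nodup_append.1 hnAB).2.2 a (List.mem_cons_of_mem _ hb) a (by simp) rfl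
            · exact hr a ha (by rw [hAB]; simp [hb])
        · have h3 : G.CuspFree (c :: (A ++ [x])) := by
            have h1' := h1
            have : c :: (q ++ [v, t]) = (c :: (A ++ [x])) ++ (B ++ [t]) := by
              have h : c :: (q ++ [v, t]) = (c :: (q ++ [v])) ++ [t] := by simp
              rw [h, hAB]; simp
            rw [this] at h1'
            exact h1'.left
          obtain ⟨A₁, hA₁⟩ : ∃ A₁, A ++ [x] = e :: A₁ := by
            cases A with
            | nil =>
              rw [hAB] at he
              exact ⟨[], by simpa using (List.cons.inj he).1.symm⟩
            | cons a A =>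
              rw [hAB] at he
              exact ⟨A ++ [x], by simpa using (List.cons.inj he).1.symm⟩
          have : x :: (r ++ c :: A ++ [x]) = (x :: r) ++ c :: (A ++ [x]) := by simp
          rw [this, hA₁]
          rw [hA₁] at h3
          exact CuspFree.glue (l := x :: r) hx h3
        · have : r ++ c :: A = (r ++ [c]) ++ A := by simp
          rw [this, hg]; simp
        · rw [hA]; simp
      exact hfy ((G.equiv x).trans ((G.equiv x).symm hcyc) hgy)
    · -- The returning path, traversed backwards, leads to `c` without a cusp with the edge to `z`.
      obtain ⟨h, k, hk⟩ : ∃ h k, h :: k = r.reverse ++ [x] := by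
        cases hrr : r.reverse with
        | nil => exact ⟨x, [], rfl⟩
        | cons a r => exact ⟨a, _, rfl⟩
      have hch : ¬ G.Cusp c h e := by
        have h3 : x :: (r ++ [c, e]) = k.reverse ++ [h, c, e] := by
          have := congrArg List.reverse hk
          simp only [List.reverse_cons, List.reverse_append, List.reverse_reverse,
            List.reverse_nil, List.nil_append, List.singleton_append] at this
          have h' : x :: (r ++ [c, e]) = (x :: r) ++ [c, e] := rfl
          rw [h', ← this]; simp
        rw [h3] at hx
        exact hx.right.2.1
      obtain ⟨B₁, hB₁⟩ : ∃ B₁, x :: B = B₁ ++ [v] := by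
        obtain ⟨B₁, w, hw⟩ : ∃ B₁ w, x :: B = B₁ ++ [w] :=
          ⟨_, _, (List.dropLast_append_getLast (List.cons_ne_nil x B)).symm⟩
        rw [hw, ← List.append_assoc] at hAB
        obtain rfl : v = w := by simpa using (List.append_inj' hAB rfl).2
        exact ⟨B₁, hw⟩
      have hcusp : G.Cusp c h z := by
        refine key (q := r.reverse ++ B₁) (q' := k ++ B) ?_ ?_ ?_
        · rw [List.append_assoc, ← hB₁, ← List.cons_append, hk]; simp
        · have e₃ : c :: (r.reverse ++ B₁ ++ [v, t]) = c :: (r.reverse ++ x :: y :: B') := by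
            have : B₁ ++ [v, t] = (B₁ ++ [v]) ++ [t] := by simp
            rw [List.append_assoc, this, ← hB₁, hB]; simp
          rw [e₃]
          have hrev : G.CuspFree (r'.reverse ++ [g, x]) := by
            have := hxr.reverse
            rw [hg] at this
            simpa using this
          have e₄ : c :: (r.reverse ++ x :: y :: B') = r'.reverse ++ g :: x :: y :: B' := by
            have := congrArg List.reverse hg
            simp only [List.reverse_cons, List.reverse_append,
              List.reverse_nil, List.nil_append, List.singleton_append] at this
            rw [← List.cons_append, this]; simp
          rw [e₄]
          have h5 : G.CuspFree (x :: y :: B') := by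
            have h1' := h1
            rw [e₂] at h1'
            exact h1'.right.tail
          exact hrev.join h5 hgy
        · rw [List.append_assoc, ← hB₁]
          have hp : (c :: (r.reverse ++ x :: B)).Perm (c :: (r ++ x :: B)) :=
            ((List.reverse_perm r).append_right _).cons c
          rw [hp.nodup_iff]
          have h6 : (c :: r ++ x :: B).Nodup := by
            rw [List.nodup_append]
            refine ⟨?_, (List.nodup_append.1 hnAB).2.1, ?_⟩
            · have hp : (r ++ [c]).Perm (c :: r) := List.perm_append_comm
              exact hp.nodup_iff.1 (List.nodup_cons.1 hn).2
            · rintro a ha b hb rfl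
              rcases List.mem_cons.1 ha with rfl | ha
              · exact (List.nodup_append.1 hnAB).2.2 a (by simp) a hb rfl
              · exact hr a ha (by rw [hAB]; simp only [List.mem_append]; exact Or.inr hb)
          exact h6
      exact hch ((G.equiv c).trans hcusp ((G.equiv c).symm (key he h1 h2)))
  · rintro rfl
    have hm : e ∈ q ∨ e = v := by
      have : e ∈ q ++ [v] := by rw [← he]; simp
      simpa using this
    exact hm.elim (fun hm => hz (hR (q := q) h1.tail h2.tail e hm)) hzv

/-- A form of Yeo's theorem. In a finite graph without cusp-free cycles let some edges be directed,
`Down c b` meaning that the edge is directed from `b` to `c`, in such a way that directed edges form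
no cusp at their source and that the edges of a cusp are directed towards it. If there is a directed
edge, then there is one whose target `c` is not the source of another, and whose source cannot be
reached from the other colours at `c` except through `c`. -/
theorem NoCycle.exists_splitting [Finite V] (hG : G.NoCycle Set.univ) (Down : V → V → Prop)
    (hadj : ∀ {c b}, Down c b → G.Adj c b) (hne : ∀ {c b}, Down c b → c ≠ b)
    (hasymm : ∀ {c b}, Down c b → ¬ Down b c)
    (hfree : ∀ {c b}, Down c b → ∀ e, G.Cusp b e c → e = c)
    (hcusp : ∀ {c a b}, G.Adj c a → G.Cusp c a b → a ≠ b → Down c a)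
    (hex : ∃ c b, Down c b) :
    ∃ c b, Down c b ∧ (∀ d, ¬ Down d c) ∧ ∀ s, G.Adj c s → s ≠ c → ¬ G.Cusp c s b →
      ¬ Relation.ReflTransGen (fun a b => G.Adj a b ∧ b ≠ c) s b := by
  by_contra! hcon
  -- Otherwise every good path that ends with a directed edge could be prolonged.
  have hlong : ∀ n : ℕ, ∃ c b p, Down c b ∧ G.Good c b p ∧ n ≤ p.length := by
    intro n
    induction n with
    | zero =>
      obtain ⟨c, b, h⟩ := hex
      exact ⟨c, b, [], h, ⟨hadj h, by simpa using hne h, hG.noReturn_edge (hfree h)⟩, by simp⟩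
    | succ n ih =>
      obtain ⟨c, b, p, h, hp, hn⟩ := ih
      by_cases hd : ∃ d, Down d c
      · obtain ⟨d, hd⟩ := hd
        refine ⟨d, c, [] ++ b :: p, hd, hp.extend (q := []) rfl ⟨hadj hd, fun hc => ?_, hadj h⟩
          (by simpa using hne hd) (hG.noReturn_edge (hfree hd)), by simpa using hn⟩
        obtain rfl := hfree hd b ((G.equiv c).symm hc)
        exact hasymm hd h
      · push Not at hd
        obtain ⟨s, hs, hsc, hsb, hconn⟩ := hcon c b h hd
        obtain ⟨d, e, q, q', z, h0, h1, h2, h3, h4, h5⟩ :=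
          hG.exists_noReturn (hadj h) (hfree h) hs hsc hsb hconn
        have hde : G.Adj d e := by
          have e₁ : q ++ [c, b] = e :: (q' ++ [b]) := by
            rw [← List.cons_append, h0]; simp
          rw [e₁] at h1
          exact h1.adj
        exact ⟨d, e, _, hcusp hde h4 h5, hp.extend h0 h1 h2 h3, by simp; omega⟩
  have := Fintype.ofFinite V
  obtain ⟨c, b, p, -, hp, hn⟩ := hlong (Fintype.card V)
  have := hp.nodup.length_le_card
  simp only [List.length_cons] at this
  omega

end CuspGraph

variable {P : Type*} {X : Type*} {F : Forest P X}

/-! ### Nodes, successors and subtrees -/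

lemma Term.sub_append (t : Term X) (p q : List ℕ) :
    t.sub (p ++ q) = (t.sub p).bind fun s => s.sub q := by
  induction p generalizing t with
  | nil => simp [Term.sub]
  | cons k p ih => simp only [List.cons_append, Term.sub, ih, Option.bind_assoc]

lemma Term.sub_singleton (t : Term X) (k : ℕ) : t.sub [k] = t.children[k]? := by
  simp [Term.sub]

lemma Forest.termAt_append (F : Forest P X) (i : ℕ) (p q : List ℕ) :
    F.termAt (i, p ++ q) = (F.termAt (i, p)).bind fun s => s.sub q := by
  simp only [Forest.termAt, Term.sub_append, Option.bind_assoc]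

namespace Forest.Node

lemma termAt_eq (n : F.Node) : F.termAt n.1 = some n.term := by
  simp [Forest.Node.term]

lemma termAt_succ (n : F.Node) (k : ℕ) :
    F.termAt (n.1.1, n.1.2 ++ [k]) = n.term.children[k]? := by
  rw [Forest.termAt_append]
  have : F.termAt (n.1.1, n.1.2) = some n.term := n.termAt_eq
  rw [this]
  simp [Term.sub_singleton]

/-- The successors of a node, in the order in which the children of its term are listed. -/
def kids (n : F.Node) : List F.Node :=
  (List.finRange n.term.children.length).map fun k : Fin n.term.children.length =>
    ⟨(n.1.1, n.1.2 ++ [k.1]), by rw [termAt_succ]; simp⟩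

lemma mem_kids {n m : F.Node} : m ∈ n.kids ↔ n.IsSucc m := by
  constructor
  · intro h
    obtain ⟨k, -, rfl⟩ := List.mem_map.1 h
    exact ⟨k, rfl⟩
  · rintro ⟨k, hk⟩
    have h := m.2
    rw [hk, termAt_succ] at h
    have hlt : k < n.term.children.length := by simpa using h
    exact List.mem_map.2 ⟨⟨k, hlt⟩, List.mem_finRange _, Subtype.ext hk.symm⟩

lemma map_term_kids (n : F.Node) : n.kids.map term = n.term.children := by
  refine List.ext_getElem (by simp [kids]) fun k h1 h2 => ?_
  have h := termAt_succ n k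
  rw [List.getElem?_eq_getElem h2] at h
  have h' : some (n.kids.map term)[k] = some n.term.children[k] := by
    rw [← h]
    simp [kids, term]
  exact Option.some.inj h'

lemma IsSucc.unique {a b c : F.Node} (h : a.IsSucc c) (h' : b.IsSucc c) : a = b := by
  obtain ⟨k, hk⟩ := h
  obtain ⟨l, hl⟩ := h'
  rw [hk, Prod.mk.injEq] at hl
  exact Subtype.ext (Prod.ext hl.1 (List.append_inj' hl.2 rfl).1)

lemma IsSucc.length {a b : F.Node} (h : a.IsSucc b) : b.1.2.length = a.1.2.length + 1 := by
  obtain ⟨k, hk⟩ := h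
  rw [hk]; simp

lemma IsSucc.asymm {a b : F.Node} (h : a.IsSucc b) : ¬ b.IsSucc a := fun h' => by
  have := h.length
  have := h'.length
  omega

lemma IsSucc.ne {a b : F.Node} (h : a.IsSucc b) : a ≠ b := by
  rintro rfl
  exact h.asymm h

lemma IsSucc.mem_children {a b : F.Node} (h : a.IsSucc b) : b.term ∈ a.term.children := by
  rw [← map_term_kids]
  exact List.mem_map_of_mem (mem_kids.2 h)

lemma not_isSucc_of_var {a b : F.Node} {x : Atom X} (h : a.term = Term.var x) :
    ¬ a.IsSucc b := fun hs => by
  have := hs.mem_children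
  simp [h, Term.children] at this

/-- The nodes of the subtree rooted at `n`. -/
def subtree (n : F.Node) : Set F.Node := {m | m.1.1 = n.1.1 ∧ n.1.2 <+: m.1.2}

lemma self_mem_subtree (n : F.Node) : n ∈ n.subtree := ⟨rfl, List.prefix_refl _⟩

lemma IsSucc.mem_subtree {n a b : F.Node} (h : a.IsSucc b) (ha : a ∈ n.subtree) :
    b ∈ n.subtree := by
  obtain ⟨k, hk⟩ := h
  exact ⟨by rw [hk]; exact ha.1, by rw [hk]; exact ha.2.trans (List.prefix_append _ _)⟩

lemma mem_subtree_trans {n m l : F.Node} (h : l ∈ m.subtree) (h' : m ∈ n.subtree) :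
    l ∈ n.subtree := ⟨h.1.trans h'.1, h'.2.trans h.2⟩

lemma mem_subtree_iff {n m : F.Node} :
    m ∈ n.subtree ↔ m = n ∨ ∃ c ∈ n.kids, m ∈ c.subtree := by
  constructor
  · rintro ⟨h1, q, hq⟩
    match q, hq with
    | [], hq => exact Or.inl (Subtype.ext (Prod.ext h1 (by simpa using hq.symm)))
    | k :: q, hq =>
      have hs : (F.termAt (n.1.1, n.1.2 ++ [k])).isSome := by
        have h := m.2
        have e : m.1 = (n.1.1, (n.1.2 ++ [k]) ++ q) := Prod.ext h1 (by rw [← hq]; simp)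
        rw [e, Forest.termAt_append] at h
        exact Option.isSome_of_isSome_bind h
      exact Or.inr ⟨⟨_, hs⟩, mem_kids.2 ⟨k, rfl⟩, h1, ⟨q, by rw [← hq]; simp⟩⟩
  · rintro (rfl | ⟨c, hc, hm⟩)
    · exact self_mem_subtree _
    · exact mem_subtree_trans hm ((mem_kids.1 hc).mem_subtree (self_mem_subtree n))

lemma subtree_eq_singleton {n : F.Node} (h : n.term.children = []) : n.subtree = {n} := by
  have : n.kids = [] := by
    rw [← map_term_kids] at h
    simpa using h
  ext m
  rw [mem_subtree_iff, this]
  simp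

lemma pairwise_disjoint_kids (n : F.Node) :
    n.kids.Pairwise fun a b => Disjoint a.subtree b.subtree := by
  rw [kids, List.pairwise_map]
  refine (List.nodup_finRange _).imp fun {k l} hkl => Set.disjoint_left.2 fun m hk hl => hkl ?_
  have h1 := List.prefix_of_prefix_length_le hk.2 hl.2 (by simp)
  have h2 := h1.eq_of_length (by simp)
  simpa [Fin.ext_iff] using h2

lemma notMem_subtree_of_isSucc {n c : F.Node} (h : n.IsSucc c) : n ∉ c.subtree := by
  rintro ⟨-, h'⟩
  have := h'.length_le
  have := h.length
  omega

/-- A node strictly inside a subtree has its predecessor in the subtree. -/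
lemma exists_isSucc_of_mem_subtree {n b : F.Node} (hb : b ∈ n.subtree) (hbn : b ≠ n) :
    ∃ a ∈ n.subtree, a.IsSucc b := by
  obtain ⟨q, hq⟩ := hb.2
  have hb1 : b.1.1 = n.1.1 := hb.1
  rcases List.eq_nil_or_concat' q with rfl | ⟨q, l, rfl⟩
  · exact absurd (Subtype.ext (Prod.ext hb1 (by simpa using hq.symm))) hbn
  · have hs : (F.termAt (n.1.1, n.1.2 ++ q)).isSome := by
      have h := b.2
      have e : b.1 = (n.1.1, (n.1.2 ++ q) ++ [l]) := Prod.ext hb1 (by rw [← hq]; simp)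
      rw [e, Forest.termAt_append] at h
      exact Option.isSome_of_isSome_bind h
    exact ⟨⟨_, hs⟩, ⟨rfl, List.prefix_append _ _⟩, l, Prod.ext hb1 (by rw [← hq]; simp)⟩

end Forest.Node

lemma Term.finite_sub (t : Term X) : {p : List ℕ | (t.sub p).isSome}.Finite := by
  suffices H : ∀ n (t : Term X), sizeOf t = n → {p : List ℕ | (t.sub p).isSome}.Finite from
    H _ t rfl
  intro n
  induction n using Nat.strong_induction_on with
  | _ n ih =>
  intro t ht
  have hc : ∀ s ∈ t.children, sizeOf s < n := by
    subst ht
    intro s hs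
    cases t with
    | sum ws =>
      have : sizeOf s < sizeOf ws := List.sizeOf_lt_of_mem hs
      simp only [Term.sum.sizeOf_spec]
      omega
    | or a b =>
      rcases (by simpa [Term.children] using hs : s = a ∨ s = b) with rfl | rfl <;>
      simp only [Term.or.sizeOf_spec] <;> omega
    | tensor a b =>
      rcases (by simpa [Term.children] using hs : s = a ∨ s = b) with rfl | rfl <;>
      simp only [Term.tensor.sizeOf_spec] <;> omega
    | _ => simp [Term.children] at hs
  refine ((Set.finite_singleton []).union (Set.finite_iUnion
    fun k : Fin t.children.length => (ih _ (hc _ (List.getElem_mem k.2)) _ rfl).image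
      (List.cons (k : ℕ)))).subset ?_
  rintro (_ | ⟨k, p⟩) hp
  · exact Or.inl rfl
  · refine Or.inr (Set.mem_iUnion.2 ?_)
    have hp' : (t.children[k]?.bind fun s => s.sub p).isSome := hp
    have hk : k < t.children.length := by
      have := Option.isSome_of_isSome_bind hp'
      simpa using this
    rw [List.getElem?_eq_getElem hk] at hp'
    exact ⟨⟨k, hk⟩, p, hp', rfl⟩

instance Forest.Node.finite : Finite F.Node := by
  have h : {a : ℕ × List ℕ | (F.termAt a).isSome}.Finite := by
    refine (Set.finite_iUnion fun i : Fin F.length =>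
      (Term.finite_sub F[i].1).image (Prod.mk (i : ℕ))).subset ?_
    rintro ⟨i, p⟩ hp
    have hp' : (F[i]?.bind fun r => r.1.sub p).isSome := hp
    have hi : i < F.length := by
      have := Option.isSome_of_isSome_bind hp'
      simpa using this
    rw [List.getElem?_eq_getElem hi] at hp'
    exact Set.mem_iUnion.2 ⟨⟨i, hi⟩, p, hp', rfl⟩
  exact h.to_subtype

/-! ### Typed nodes -/

lemma HasType.sub {τ : X → Option P} {t s : Term X} {T : Typ P} (h : HasType τ t T)
    {p : List ℕ} (hs : t.sub p = some s) : s = Term.star ∨ ∃ S, HasType τ s S := by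
  suffices H : ∀ t : Term X, (t = Term.star ∨ ∃ S, HasType τ t S) → t.sub p = some s →
      s = Term.star ∨ ∃ S, HasType τ s S from H t (Or.inr ⟨T, h⟩) hs
  clear hs h
  induction p with
  | nil =>
    intro t ht h
    obtain rfl : t = s := by simpa [Term.sub] using h
    exact ht
  | cons k p ih =>
    intro t ht h
    obtain ⟨c, hc, hcs⟩ := Option.bind_eq_some_iff.1 h
    refine ih c ?_ hcs
    have hm := List.mem_of_getElem? hc
    rcases ht with rfl | ⟨S, hS⟩
    · simp [Term.children] at hm
    · cases hS with
      | one => simp [Term.children] at hm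
      | var => simp [Term.children] at hm
      | or a b A B ha hb =>
        rcases (by simpa [Term.children] using hm : c = a ∨ c = b) with rfl | rfl
        exacts [Or.inr ⟨_, ha⟩, Or.inr ⟨_, hb⟩]
      | orStar a A B ha =>
        rcases (by simpa [Term.children] using hm : c = a ∨ c = Term.star) with rfl | rfl
        exacts [Or.inr ⟨_, ha⟩, Or.inl rfl]
      | starOr b A B hb =>
        rcases (by simpa [Term.children] using hm : c = Term.star ∨ c = b) with rfl | rfl
        exacts [Or.inl rfl, Or.inr ⟨_, hb⟩]
      | tensor a b A B ha hb =>
        rcases (by simpa [Term.children] using hm : c = a ∨ c = b) with rfl | rfl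
        exacts [Or.inr ⟨_, ha⟩, Or.inr ⟨_, hb⟩]
      | sumAtom ws a hne hw => exact Or.inr ⟨_, hw c hm⟩
      | sumAnd ws A B hne hw => exact Or.inr ⟨_, hw c hm⟩

lemma Forest.IsTyped.exists_isSucc (hF : F.IsTyped) {n : F.Node} (h : n.term.IsSwitched) :
    ∃ m, n.IsSucc m := by
  obtain ⟨τ, hτ⟩ := hF.typed
  have hn := n.termAt_eq
  obtain ⟨r, hr, hrn⟩ := Option.bind_eq_some_iff.1 hn
  have hk : n.kids ≠ [] := by
    intro hk
    have hc : n.term.children = [] := by rw [← Forest.Node.map_term_kids, hk]; rfl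
    rcases (hτ r (List.mem_of_getElem? hr)).sub hrn with ht | ⟨S, hS⟩
    · rw [ht] at h
      exact h
    · revert hc h hS
      generalize n.term = t
      intro h hc hS
      revert h hc
      cases hS with
      | sumAtom ws a hne hw => exact fun _ hc => hne hc
      | sumAnd ws A B hne hw => exact fun _ hc => hne hc
      | or => exact fun _ hc => by simp [Term.children] at hc
      | orStar => exact fun h _ => h.2 rfl
      | starOr => exact fun h _ => h.1 rfl
      | _ => exact fun h _ => h
  obtain ⟨m, hm⟩ := List.exists_mem_of_ne_nil _ hk
  exact ⟨m, Forest.Node.mem_kids.1 hm⟩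

/-! ### AC-correctness in terms of cusps -/

lemma Forest.Edge.not_isSucc {a b : F.Node} (h : F.Edge a b) : ¬ a.IsSucc b := by
  rcases h with h | ⟨x, ha, -⟩
  · exact h.asymm
  · exact Forest.Node.not_isSucc_of_var ha

/-- The undirected graph of a forest, with cusps at the switched nodes: all edges to the successors
of a switched node have the same colour there, so that a cusp-free path does not join two of them,
and all other pairs of distinct edges have distinct colours. -/
def Forest.cuspGraph (F : Forest P X) : CuspGraph F.Node where
  Adj a b := F.Edge a b ∨ F.Edge b a
  symm h := h.symm
  Cusp v a b := a = b ∨ v.term.IsSwitched ∧ v.IsSucc a ∧ v.IsSucc b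
  equiv v :=
    { refl := fun _ => Or.inl rfl
      symm := by
        rintro a b (rfl | ⟨h1, h2, h3⟩)
        exacts [Or.inl rfl, Or.inr ⟨h1, h3, h2⟩]
      trans := by
        rintro a b c (rfl | ⟨h1, h2, h3⟩) (rfl | ⟨h4, h5, h6⟩)
        exacts [Or.inl rfl, Or.inr ⟨h4, h5, h6⟩, Or.inr ⟨h1, h2, h3⟩, Or.inr ⟨h1, h2, h6⟩] }

/-- If there are no cusp-free cycles, then every switching graph is acyclic: a path in a switching
graph meets no cusp. -/
lemma Forest.acCorrect_of_noCycle (h : F.cuspGraph.NoCycle Set.univ) : F.ACCorrect := by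
  intro σ
  have hadj : ∀ {a b}, σ.graph.Adj a b → F.cuspGraph.Adj a b := by
    intro a b hab
    have := (SimpleGraph.fromRel_adj _ _ _).1 hab
    exact this.2.imp And.left And.left
  have hchoice : ∀ {a b} (ha : a.term.IsSwitched), σ.graph.Adj a b → a.IsSucc b →
      b = σ.choice a ha := by
    intro a b ha hab hs
    rcases ((SimpleGraph.fromRel_adj _ _ _).1 hab).2 with h | h
    · exact (h.1.not_isSucc hs).elim
    · exact h.2 ha
  have hcusp : ∀ {a b c}, σ.graph.Adj b a → σ.graph.Adj b c → a ≠ c →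
      ¬ F.cuspGraph.Cusp b a c := by
    rintro a b c hba hbc hac (rfl | ⟨h1, h2, h3⟩)
    · exact hac rfl
    · exact hac ((hchoice h1 hba h2).trans (hchoice h1 hbc h3).symm)
  have hpath : ∀ {a b} (p : σ.graph.Walk a b), p.IsPath → F.cuspGraph.CuspFree p.support := by
    intro a b p hp
    induction p with
    | nil => trivial
    | @cons a b c hab q ih =>
      cases q with
      | nil => exact hadj hab
      | @cons _ d _ hbd r =>
        have ih' := ih ((SimpleGraph.Walk.cons_isPath_iff _ _).1 hp).1
        have hn := ((SimpleGraph.Walk.cons_isPath_iff _ _).1 hp).2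
        rw [SimpleGraph.Walk.support_cons, ← SimpleGraph.Walk.cons_tail_support r] at ih'
        rw [SimpleGraph.Walk.support_cons, SimpleGraph.Walk.support_cons,
          ← SimpleGraph.Walk.cons_tail_support r]
        refine ⟨hadj hab, hcusp hab.symm hbd ?_, ih'⟩
        rintro rfl
        exact hn (by simp)
  intro v c hc
  cases c with
  | nil => exact hc.ne_nil rfl
  | @cons _ u _ hvu p =>
    obtain ⟨hp, he⟩ := (SimpleGraph.Walk.cons_isCycle_iff _ _).1 hc
    obtain ⟨l, hl⟩ : ∃ l, p.support = u :: (l ++ [v]) := by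
      cases p with
      | nil => exact (hvu.ne rfl).elim
      | cons h q =>
        have := List.dropLast_append_getLast q.support_ne_nil
        rw [SimpleGraph.Walk.getLast_support] at this
        exact ⟨_, by rw [SimpleGraph.Walk.support_cons, this]⟩
    have hcf := hpath p hp
    have hn := hp.support_nodup
    have hch := p.isChain_adj_support
    rw [hl] at hcf hn hch
    rcases List.eq_nil_or_concat' l with rfl | ⟨k, w, rfl⟩
    · cases p with
      | nil => exact (hvu.ne rfl).elim
      | cons h q =>
        cases q with
        | nil => exact he (by simp [Sym2.eq_swap])
        | cons h' r => simp at hl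
    obtain ⟨f, m, hf⟩ : ∃ f m, f :: m = k ++ [w] := by
      cases k with
      | nil => exact ⟨w, [], rfl⟩
      | cons a k => exact ⟨a, _, rfl⟩
    have huf : σ.graph.Adj u f := by
      rw [← hf] at hch
      exact (List.isChain_cons_cons.1 hch).1
    have hwv : σ.graph.Adj w v := by
      have : u :: (k ++ [w] ++ [v]) = (u :: k) ++ [w, v] := by simp
      rw [this] at hch
      exact List.isChain_pair.1 hch.right_of_append
    have hvf : v ≠ f := by
      rintro rfl
      rw [← hf] at hn
      simp at hn
    have hwu : w ≠ u := by
      rintro rfl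
      simp at hn
    refine h (v :: u :: (k ++ [w])) ⟨?_, ?_⟩ (by simp)
    · have hp : (u :: (k ++ [w] ++ [v])).Perm (v :: u :: (k ++ [w])) :=
        List.perm_append_comm (l₁ := u :: (k ++ [w])) (l₂ := [v])
      exact hp.nodup_iff.1 hn
    · have h1 : F.cuspGraph.CuspFree ((v :: u :: k) ++ [w, v]) := by
        have : (v :: u :: k) ++ [w, v] = v :: u :: f :: (m ++ [v]) := by
          rw [← List.cons_append, hf]; simp
        rw [this]
        rw [← hf] at hcf
        exact ⟨hadj hvu, hcusp hvu.symm huf hvf, hcf⟩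
      have h2 : F.cuspGraph.CuspFree [w, v, u] := ⟨hadj hwv, hcusp hwv.symm hvu hwu, hadj hvu⟩
      simpa using h1.glue h2

/-- A cusp-free cycle is contained in the switching graph of every switching which chooses, for the
switched nodes on the cycle, the successor (at most one) that precedes or follows on the cycle. -/
lemma Forest.ACCorrect.noCycle (hF : F.IsTyped) (h : F.ACCorrect) :
    F.cuspGraph.NoCycle Set.univ := by
  classical
  intro L hL _
  obtain ⟨n, f, hf, hcyc⟩ := hL.exists_enum
  have hex : ∀ a : F.Node, a.term.IsSwitched → ∃ b, a.IsSucc b ∧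
      ∀ i, f i = a → ∀ j, (j = i + 1 ∨ i = j + 1) → a.IsSucc (f j) → f j = b := by
    intro a ha
    by_cases hb : ∃ i j, f i = a ∧ (j = i + 1 ∨ i = j + 1) ∧ a.IsSucc (f j)
    · obtain ⟨i, j, rfl, hij, hs⟩ := hb
      refine ⟨f j, hs, fun i' hi' k hk hsk => ?_⟩
      obtain rfl := hf hi'
      rcases hij with rfl | rfl <;> rcases hk with rfl | hk
      · rfl
      · subst hk
        exact ((hcyc k).2 (Or.inr ⟨ha, hsk, hs⟩)).elim
      · exact ((hcyc j).2 (Or.inr ⟨ha, hs, hsk⟩)).elim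
      · rw [add_right_cancel hk]
    · obtain ⟨b, hb'⟩ := hF.exists_isSucc ha
      exact ⟨b, hb', fun i hi j hj hs => (hb ⟨i, j, hi, hj, hs⟩).elim⟩
  choose g hg using hex
  let σ : F.Switching := ⟨g, fun a ha => (hg a ha).1⟩
  have hedge : ∀ i j, (j = i + 1 ∨ i = j + 1) → F.Edge (f i) (f j) → σ.graph.Adj (f i) (f j) := by
    intro i j hij he
    refine (SimpleGraph.fromRel_adj _ _ _).2 ⟨fun h => ?_, Or.inl ⟨he, fun hs => ?_⟩⟩
    · obtain rfl := hf h
      rcases he with he | ⟨x, h1, h2⟩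
      · exact he.ne rfl
      · rw [h1] at h2
        simp at h2
    · rcases he with he | ⟨x, h1, h2⟩
      · exact (hg _ hs).2 j rfl i hij.symm he
      · rw [h2] at hs
        exact hs.elim
  have hadj : ∀ i, σ.graph.Adj (f i) (f (i + 1)) := by
    intro i
    rcases (hcyc i).1 with he | he
    · exact hedge _ _ (Or.inl rfl) he
    · exact (hedge _ _ (Or.inr rfl) he).symm
  refine SimpleGraph.isAcyclic_iff_free_cycleGraph.1 (h σ) (n + 3) (by omega)
    ⟨⟨⟨f, ?_⟩, hf⟩⟩
  intro a b hab
  rcases SimpleGraph.cycleGraph_adj.1 hab with hab | hab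
  · rw [sub_eq_iff_eq_add'.1 hab]
    exact (hadj b).symm
  · rw [sub_eq_iff_eq_add'.1 hab]
    exact hadj a

/-! ### Sub-forests given by lists of nodes -/

namespace Forest

/-- The nodes in the subtrees rooted at the nodes in `L`. -/
def nodesBelow (L : List F.Node) : Set F.Node := {m | ∃ n ∈ L, m ∈ n.subtree}

/-- The subtrees rooted at the nodes in `L` are pairwise disjoint. -/
def IsDisjoint (L : List F.Node) : Prop :=
  L.Pairwise fun a b => Disjoint a.subtree b.subtree

/-- Each wire variable occurring in `U` has its dual in `U`. -/
def WireClosed (U : Set F.Node) : Prop :=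
  ∀ (x : X) (i : Bool), ∀ a ∈ U, a.term = Term.var (x, i) → ∃ b ∈ U, b.term = Term.var (x, !i)

/-- Each wire variable occurs at most once. -/
def IsLinear (F : Forest P X) : Prop :=
  ∀ (x : Atom X) (a b : F.Node), a.term = Term.var x → b.term = Term.var x → a = b

lemma nodesBelow_perm {L M : List F.Node} (h : L.Perm M) : nodesBelow L = nodesBelow M := by
  ext m
  simp only [nodesBelow, Set.mem_ofPred_eq, h.mem_iff]

lemma nodesBelow_append (L M : List F.Node) :
    nodesBelow (L ++ M) = nodesBelow L ∪ nodesBelow M := by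
  ext m
  simp only [nodesBelow, Set.mem_ofPred_eq, Set.mem_union, List.mem_append, or_and_right,
    exists_or]

lemma nodesBelow_cons (n : F.Node) (L : List F.Node) :
    nodesBelow (n :: L) = n.subtree ∪ nodesBelow L := by
  ext m
  simp [nodesBelow]

lemma nodesBelow_nil : nodesBelow ([] : List F.Node) = ∅ := by
  ext m
  simp [nodesBelow]

lemma mem_nodesBelow_of_mem {L : List F.Node} {n : F.Node} (h : n ∈ L) : n ∈ nodesBelow L :=
  ⟨n, h, n.self_mem_subtree⟩

lemma nodesBelow_cons_kids (n : F.Node) (L : List F.Node) :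
    nodesBelow (n :: L) = insert n (nodesBelow (n.kids ++ L)) := by
  ext m
  rw [nodesBelow_cons, nodesBelow_append, Set.mem_union, Node.mem_subtree_iff, or_assoc]
  rfl

lemma mem_nodesBelow_of_isSucc {L : List F.Node} {a b : F.Node} (h : a.IsSucc b)
    (ha : a ∈ nodesBelow L) : b ∈ nodesBelow L :=
  let ⟨n, hn, hm⟩ := ha
  ⟨n, hn, h.mem_subtree hm⟩

lemma IsDisjoint.perm {L M : List F.Node} (h : IsDisjoint L) (hp : L.Perm M) : IsDisjoint M :=
  (hp.pairwise_iff fun h => Disjoint.symm h).1 h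

lemma isDisjoint_append {L M : List F.Node} :
    IsDisjoint (L ++ M) ↔
      IsDisjoint L ∧ IsDisjoint M ∧ Disjoint (nodesBelow L) (nodesBelow M) := by
  rw [IsDisjoint, List.pairwise_append]
  refine and_congr Iff.rfl (and_congr Iff.rfl ⟨fun h => ?_, fun h a ha b hb => ?_⟩)
  · rw [Set.disjoint_left]
    rintro m ⟨a, ha, hma⟩ ⟨b, hb, hmb⟩
    exact Set.disjoint_left.1 (h a ha b hb) hma hmb
  · rw [Set.disjoint_left] at h ⊢
    exact fun m hma hmb => h ⟨a, ha, hma⟩ ⟨b, hb, hmb⟩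

lemma isDisjoint_cons {n : F.Node} {L : List F.Node} :
    IsDisjoint (n :: L) ↔ IsDisjoint L ∧ Disjoint n.subtree (nodesBelow L) := by
  have := isDisjoint_append (L := [n]) (M := L)
  simpa [IsDisjoint, nodesBelow_cons, nodesBelow_nil] using this

lemma nodesBelow_kids_subset (n : F.Node) : nodesBelow n.kids ⊆ n.subtree :=
  fun _ ⟨c, hc, hm⟩ => Node.mem_subtree_iff.2 (Or.inr ⟨c, hc, hm⟩)

lemma IsDisjoint.kids {n : F.Node} {L : List F.Node} (h : IsDisjoint (n :: L)) :
    IsDisjoint (n.kids ++ L) := by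
  obtain ⟨h1, h2⟩ := isDisjoint_cons.1 h
  exact isDisjoint_append.2 ⟨n.pairwise_disjoint_kids, h1, h2.mono_left (nodesBelow_kids_subset n)⟩

/-- The roots of disjoint subtrees have no predecessor in them. -/
lemma IsDisjoint.not_isSucc {n a : F.Node} {L : List F.Node} (h : IsDisjoint (n :: L))
    (ha : a ∈ nodesBelow (n :: L)) : ¬ a.IsSucc n := by
  intro hs
  rw [nodesBelow_cons] at ha
  rcases ha with ha | ⟨m, hm, ha⟩
  · have := hs.length
    have := ha.2.length_le
    omega
  · exact Set.disjoint_left.1 (isDisjoint_cons.1 h).2 n.self_mem_subtree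
      ⟨m, hm, hs.mem_subtree ha⟩

lemma IsDisjoint.adj_iff {n a : F.Node} {L : List F.Node} (h : IsDisjoint (n :: L))
    (hn : ∀ x, n.term ≠ Term.var x) (ha : a ∈ nodesBelow (n :: L)) :
    F.cuspGraph.Adj n a ↔ n.IsSucc a := by
  refine ⟨?_, fun hs => Or.inr (Or.inl hs)⟩
  rintro ((hs | ⟨x, hx, -⟩) | (hs | ⟨x, -, hx⟩))
  · exact (h.not_isSucc ha hs).elim
  · exact (hn _ hx).elim
  · exact hs
  · exact (hn _ hx).elim

lemma WireClosed.insert_node {U : Set F.Node} (h : WireClosed U) {n : F.Node}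
    (hn : ∀ x, n.term ≠ Term.var x) : WireClosed (insert n U) := by
  rintro x i a (rfl | ha) hx
  · exact (hn _ hx).elim
  · obtain ⟨b, hb, hx'⟩ := h x i a ha hx
    exact ⟨b, Or.inr hb, hx'⟩

lemma WireClosed.union {U W : Set F.Node} (h : WireClosed U) (h' : WireClosed W) :
    WireClosed (U ∪ W) := by
  rintro x i a (ha | ha) hx
  · obtain ⟨b, hb, hx'⟩ := h x i a ha hx
    exact ⟨b, Or.inl hb, hx'⟩
  · obtain ⟨b, hb, hx'⟩ := h' x i a ha hx
    exact ⟨b, Or.inr hb, hx'⟩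

lemma WireClosed.mem_of_wire {U : Set F.Node} (h : WireClosed U) (hF : F.IsLinear) {x : X}
    {i : Bool} {a b : F.Node} (ha : a ∈ U) (hx : a.term = Term.var (x, i))
    (hy : b.term = Term.var (x, !i)) : b ∈ U := by
  obtain ⟨c, hc, hx'⟩ := h x i a ha hx
  rwa [hF _ _ _ hy hx']

/-- Disjoint sub-forests, one of them closed under duality of wire variables, are not joined by an
edge. -/
lemma not_adj_of_wireClosed (hF : F.IsLinear) {L M : List F.Node} (h : IsDisjoint (L ++ M))
    (hL : WireClosed (nodesBelow L)) {a b : F.Node} (ha : a ∈ nodesBelow L)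
    (hb : b ∈ nodesBelow M) : ¬ F.cuspGraph.Adj a b := by
  have hd := Set.disjoint_left.1 (isDisjoint_append.1 h).2.2
  rintro ((hs | ⟨x, hx, hy⟩) | (hs | ⟨x, hx, hy⟩))
  · exact hd ha (mem_nodesBelow_of_isSucc hs hb)
  · exact hd (hL.mem_of_wire hF ha hx hy) hb
  · exact hd (mem_nodesBelow_of_isSucc hs ha) hb
  · exact hd (hL.mem_of_wire hF ha hy hx) hb

end Forest

/-! ### Absence of cycles in unions -/

namespace CuspGraph

variable {V : Type*} {G : CuspGraph V}

lemma CuspFree.subset_of_head {U W : Set V} (hsep : ∀ a ∈ U, ∀ b ∈ W, ¬ G.Adj a b) {a : V}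
    {l : List V} (h : G.CuspFree (a :: l)) (ha : a ∈ U) (hl : ∀ v ∈ a :: l, v ∈ U ∪ W) :
    ∀ v ∈ a :: l, v ∈ U := by
  induction l generalizing a with
  | nil => simpa using ha
  | cons b l ih =>
    have hb : b ∈ U := (hl b (by simp)).resolve_right fun hb => hsep a ha b hb h.adj
    intro v hv
    rcases List.mem_cons.1 hv with rfl | hv
    · exact ha
    · exact ih h.tail hb (fun v hv => hl v (List.mem_cons_of_mem _ hv)) v hv

/-- Adding to two parts that are not joined by an edge a node all of whose edges into either part
have the same colour creates no cusp-free cycle. -/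
lemma NoCycle.insert_union {U W : Set V} (hU : G.NoCycle U) (hW : G.NoCycle W)
    (hsep : ∀ a ∈ U, ∀ b ∈ W, ¬ G.Adj a b) {n : V}
    (hnU : ∀ a ∈ U, ∀ b ∈ U, G.Adj n a → G.Adj n b → G.Cusp n a b)
    (hnW : ∀ a ∈ W, ∀ b ∈ W, G.Adj n a → G.Adj n b → G.Cusp n a b) :
    G.NoCycle (insert n (U ∪ W)) := by
  have hsep' : ∀ a ∈ W, ∀ b ∈ U, ¬ G.Adj a b := fun a ha b hb h => hsep b hb a ha (G.symm h)
  intro L hL hLU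
  by_cases hn : n ∈ L
  · obtain ⟨M, hM, hp⟩ := hL.exists_head hn
    match M, hM, hp with
    | b :: M, ⟨h1, h2⟩, hp =>
      have hmem : ∀ v ∈ b :: M, v ∈ U ∪ W := fun v hv =>
        (hLU v (hp.mem_iff.1 (List.mem_cons_of_mem _ hv))).resolve_left fun h => by
          subst h; exact (List.nodup_cons.1 h1).1 hv
      obtain ⟨k, c, hk⟩ : ∃ k c, b :: M = k ++ [c] :=
        ⟨_, _, (List.dropLast_append_getLast (List.cons_ne_nil b M)).symm⟩
      have hcm : c ∈ b :: M := by rw [hk]; simp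
      have h3 : G.CuspFree ((b :: M) ++ [n, b]) := h2.tail
      have h4 := h3
      rw [hk, List.append_assoc] at h4
      have h5 : G.Adj c n ∧ ¬ G.Cusp n c b ∧ G.Adj n b := h4.right
      rcases hmem b (by simp) with hb | hb
      · exact h5.2.1 (hnU c (h3.left.subset_of_head hsep hb hmem c hcm) b hb (G.symm h5.1) h5.2.2)
      · exact h5.2.1 (hnW c (h3.left.subset_of_head hsep' hb
          (fun v hv => (hmem v hv).symm) c hcm) b hb (G.symm h5.1) h5.2.2)
  · match L, hL, hLU, hn with
    | a :: b :: M, ⟨h1, h2⟩, hLU, hn =>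
      have hmem : ∀ v ∈ a :: b :: M, v ∈ U ∪ W := fun v hv =>
        (hLU v hv).resolve_left fun h => by subst h; exact hn hv
      have h3 : G.CuspFree (a :: b :: M) := CuspFree.left (l := a :: b :: M) h2
      rcases hmem a (by simp) with ha | ha
      · exact hU (a :: b :: M) ⟨h1, h2⟩ (h3.subset_of_head hsep ha hmem)
      · exact hW (a :: b :: M) ⟨h1, h2⟩ (h3.subset_of_head hsep' ha fun v hv => (hmem v hv).symm)

lemma noCycle_empty : G.NoCycle ∅ := by
  intro L hL h
  match L, hL, h with
  | a :: _ :: _, _, h => exact h a (by simp)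

lemma NoCycle.insert {U : Set V} (hU : G.NoCycle U) {n : V}
    (hn : ∀ a ∈ U, ∀ b ∈ U, G.Adj n a → G.Adj n b → G.Cusp n a b) :
    G.NoCycle (insert n U) := by
  simpa using hU.insert_union noCycle_empty (by simp) hn (by simp)

lemma NoCycle.union {U W : Set V} (hU : G.NoCycle U) (hW : G.NoCycle W)
    (hsep : ∀ a ∈ U, ∀ b ∈ W, ¬ G.Adj a b) : G.NoCycle (U ∪ W) := by
  have hsep' : ∀ a ∈ W, ∀ b ∈ U, ¬ G.Adj a b := fun a ha b hb h => hsep b hb a ha (G.symm h)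
  intro L hL hmem
  match L, hL, hmem with
  | a :: b :: M, ⟨h1, h2⟩, hmem =>
    have h3 : G.CuspFree (a :: b :: M) := CuspFree.left (l := a :: b :: M) h2
    rcases hmem a (by simp) with ha | ha
    · exact hU (a :: b :: M) ⟨h1, h2⟩ (h3.subset_of_head hsep ha hmem)
    · exact hW (a :: b :: M) ⟨h1, h2⟩ (h3.subset_of_head hsep' ha fun v hv => (hmem v hv).symm)

end CuspGraph

/-! ### Derivable sequents are AC-correct -/

namespace Forest

/-- The sub-forest given by `L` has no cusp-free cycle and is closed under duality of wire
variables. -/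
structure IsNet (L : List F.Node) : Prop where
  noCycle : F.cuspGraph.NoCycle (nodesBelow L)
  wireClosed : WireClosed (nodesBelow L)

lemma IsNet.perm {L M : List F.Node} (h : IsNet L) (hp : L.Perm M) : IsNet M :=
  ⟨nodesBelow_perm hp ▸ h.noCycle, nodesBelow_perm hp ▸ h.wireClosed⟩

lemma IsNet.append (hF : F.IsLinear) {L M : List F.Node} (hL : IsNet L) (hM : IsNet M)
    (hd : IsDisjoint (L ++ M)) : IsNet (L ++ M) := by
  constructor
  · rw [nodesBelow_append]
    exact hL.noCycle.union hM.noCycle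
      fun a ha b hb => not_adj_of_wireClosed hF hd hL.wireClosed ha hb
  · rw [nodesBelow_append]
    exact hL.wireClosed.union hM.wireClosed

/-- A switched node can be put below its successors. -/
lemma IsNet.of_switched {n : F.Node} {L : List F.Node} (hd : IsDisjoint (n :: L))
    (hn : n.term.IsSwitched) (h : IsNet (n.kids ++ L)) : IsNet (n :: L) := by
  have hv : ∀ x, n.term ≠ Term.var x := fun x hx => by rw [hx] at hn; exact hn
  constructor
  · rw [nodesBelow_cons_kids]
    refine h.noCycle.insert fun a ha b hb hna hnb => ?_
    have hsub : nodesBelow (n.kids ++ L) ⊆ nodesBelow (n :: L) := by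
      rw [nodesBelow_cons_kids]; exact Set.subset_insert _ _
    exact Or.inr ⟨hn, (hd.adj_iff hv (hsub ha)).1 hna, (hd.adj_iff hv (hsub hb)).1 hnb⟩
  · rw [nodesBelow_cons_kids]
    exact h.wireClosed.insert_node hv

/-- A node can be put below one of two successors if the other one is `*`. -/
lemma IsNet.of_star {n c s : F.Node} {L : List F.Node} (hd : IsDisjoint (n :: L))
    (hn : ∀ x, n.term ≠ Term.var x) (hk : n.kids.Perm [c, s]) (hs : s.term = Term.star)
    (h : IsNet (c :: L)) : IsNet (n :: L) := by
  have hsv : ∀ x, s.term ≠ Term.var x := by simp [hs]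
  have hp : (n.kids ++ L).Perm (s :: c :: L) :=
    (hk.append_right L).trans (List.Perm.swap _ _ _)
  have hU : nodesBelow (n :: L) = insert s (insert n (nodesBelow (c :: L))) := by
    have hkid : s.kids = [] := by
      have := s.map_term_kids
      rw [hs] at this
      simpa [Term.children] using this
    rw [nodesBelow_cons_kids, nodesBelow_perm hp, nodesBelow_cons_kids, hkid, List.nil_append,
      Set.insert_comm]
  have hns : n.IsSucc s := Node.mem_kids.1 (hk.mem_iff.2 (by simp))
  have hsleaf : ∀ a, ¬ s.IsSucc a := fun a ha => by
    have := ha.mem_children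
    simp [hs, Term.children] at this
  have hnet : s ∉ nodesBelow (c :: L) := 
    Set.disjoint_left.1 (isDisjoint_cons.1 (hd.kids.perm hp)).2 s.self_mem_subtree
  have hone : ∀ a ∈ nodesBelow (c :: L), F.cuspGraph.Adj n a → a = c := by
    intro a ha hna
    have ha' : a ∈ nodesBelow (n :: L) := by rw [hU]; exact Or.inr (Or.inr ha)
    have hm := hk.mem_iff.1 (Node.mem_kids.2 ((hd.adj_iff hn ha').1 hna))
    rcases (by simpa using hm : a = c ∨ a = s) with rfl | rfl
    · rfl
    · exact (hnet ha).elim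
  have hsone : ∀ a, F.cuspGraph.Adj s a → a = n := by
    rintro a ((h | ⟨x, hx, -⟩) | (h | ⟨x, -, hx⟩))
    · exact h.unique hns
    · exact (hsv _ hx).elim
    · exact (hsleaf a h).elim
    · exact (hsv _ hx).elim
  constructor
  · rw [hU]
    refine (h.noCycle.insert fun a ha b hb hna hnb => ?_).insert fun a _ b _ hna hnb => ?_
    · exact Or.inl ((hone a ha hna).trans (hone b hb hnb).symm)
    · exact Or.inl ((hsone a hna).trans (hsone b hnb).symm)
  · rw [hU]
    exact (h.wireClosed.insert_node hn).insert_node hsv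

/-- A node with two successors can be put below two disjoint nets, whether it is switched or not. -/
lemma IsNet.of_two (hF : F.IsLinear) {n c d : F.Node} {L M : List F.Node}
    (hd : IsDisjoint (n :: (L ++ M))) (hn : ∀ x, n.term ≠ Term.var x) (hk : n.kids = [c, d])
    (hL : IsNet (c :: L)) (hM : IsNet (d :: M)) : IsNet (n :: (L ++ M)) := by
  have hp : (n.kids ++ (L ++ M)).Perm ((c :: L) ++ (d :: M)) := by
    rw [hk]
    exact (List.perm_middle (l₁ := L)).symm.cons c
  have hU : nodesBelow (n :: (L ++ M)) =
      insert n (nodesBelow (c :: L) ∪ nodesBelow (d :: M)) := by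
    rw [nodesBelow_cons_kids, nodesBelow_perm hp, nodesBelow_append]
  have hd' := hd.kids.perm hp
  have hdis := Set.disjoint_left.1 (isDisjoint_append.1 hd').2.2
  have hkids : ∀ a ∈ nodesBelow (c :: L) ∪ nodesBelow (d :: M), F.cuspGraph.Adj n a →
      a = c ∨ a = d := by
    intro a ha hna
    have ha' : a ∈ nodesBelow (n :: (L ++ M)) := by rw [hU]; exact Or.inr ha
    have hm := Node.mem_kids.2 ((hd.adj_iff hn ha').1 hna)
    simpa [hk] using hm
  constructor
  · rw [hU]
    refine hL.noCycle.insert_union hM.noCycle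
      (fun a ha b hb => not_adj_of_wireClosed hF hd' hL.wireClosed ha hb) ?_ ?_
    · have : ∀ a ∈ nodesBelow (c :: L), F.cuspGraph.Adj n a → a = c := fun a ha hna =>
        (hkids a (Or.inl ha) hna).resolve_right fun h => hdis ha
          (h ▸ mem_nodesBelow_of_mem (by simp))
      exact fun a ha b hb hna hnb => Or.inl ((this a ha hna).trans (this b hb hnb).symm)
    · have : ∀ a ∈ nodesBelow (d :: M), F.cuspGraph.Adj n a → a = d := fun a ha hna =>
        (hkids a (Or.inr ha) hna).resolve_left fun h => hdis
          (h ▸ mem_nodesBelow_of_mem (by simp)) ha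
      exact fun a ha b hb hna hnb => Or.inl ((this a ha hna).trans (this b hb hnb).symm)
  · rw [hU]
    exact (hL.wireClosed.union hM.wireClosed).insert_node hn

/-- The nodes which represent a term as a root: an expansion is represented by its members, which
makes the representation insensitive to contraction, and any other term by a single node. -/
def Represents (ns : List F.Node) : Term X → Prop
  | Term.sum ws => ns.map Node.term = ws
  | t => ∃ n, ns = [n] ∧ n.term = t

/-- The nodes in `L` represent the roots of the sequent `G`. -/
def RepresentsForest : List F.Node → Forest P X → Prop
  | L, [] => L = []
  | L, r :: G => ∃ ns M, L.Perm (ns ++ M) ∧ Represents ns r.1 ∧ RepresentsForest M G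

/-- The node itself, or its successors if it is an expansion. -/
def unfolded (n : F.Node) : List F.Node :=
  match n.term with
  | Term.sum _ => n.kids
  | _ => [n]

lemma represents_unfolded (n : F.Node) : Represents (unfolded n) n.term := by
  have h := n.map_term_kids
  unfold unfolded
  cases ht : n.term with
  | sum ws => rw [ht] at h; exact h
  | _ => exact ⟨n, rfl, ht⟩

lemma IsDisjoint.unfolded {n : F.Node} {L : List F.Node} (h : IsDisjoint (n :: L)) :
    IsDisjoint (unfolded n ++ L) := by
  unfold Forest.unfolded
  split
  · exact h.kids
  · exact h

lemma IsNet.of_unfolded {n : F.Node} {L : List F.Node} (hd : IsDisjoint (n :: L))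
    (h : IsNet (unfolded n ++ L)) : IsNet (n :: L) := by
  unfold unfolded at h
  split at h
  · rename_i ht
    exact .of_switched hd (by rw [ht]; trivial) h
  · exact h

lemma RepresentsForest.exch {L : List F.Node} {G H : Forest P X} (h : RepresentsForest L G)
    (hp : G.Perm H) : RepresentsForest L H := by
  induction hp generalizing L with
  | nil => exact h
  | cons r _ ih =>
    obtain ⟨ns, M, h1, h2, h3⟩ := h
    exact ⟨ns, M, h1, h2, ih h3⟩
  | swap r s G =>
    obtain ⟨ns, M, h1, h2, ms, N, h3, h4, h5⟩ := h
    refine ⟨ms, ns ++ N, ?_, h4, ns, N, List.Perm.refl _, h2, h5⟩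
    refine h1.trans ((h3.append_left ns).trans ?_)
    rw [← List.append_assoc, ← List.append_assoc]
    exact List.perm_append_comm.append_right N
  | trans _ _ ih1 ih2 => exact ih2 (ih1 h)

lemma RepresentsForest.append {L : List F.Node} {G H : Forest P X}
    (h : RepresentsForest L (G ++ H)) :
    ∃ L₁ L₂, L.Perm (L₁ ++ L₂) ∧ RepresentsForest L₁ G ∧ RepresentsForest L₂ H := by
  induction G generalizing L with
  | nil => exact ⟨[], L, List.Perm.refl _, rfl, h⟩
  | cons r G ih =>
    obtain ⟨ns, M, h1, h2, h3⟩ := h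
    obtain ⟨M₁, M₂, h4, h5, h6⟩ := ih h3
    refine ⟨ns ++ M₁, M₂, h1.trans ?_, ⟨ns, M₁, List.Perm.refl _, h2, h5⟩, h6⟩
    rw [List.append_assoc]
    exact h4.append_left ns

lemma RepresentsForest.unfolded_cons {n : F.Node} {L : List F.Node} {G : Forest P X}
    {T : Typ P} (h : RepresentsForest L G) :
    RepresentsForest (unfolded n ++ L) ((n.term, T) :: G) :=
  ⟨_, _, List.Perm.refl _, represents_unfolded n, h⟩

lemma kids_eq_pair {n : F.Node} {t s : Term X} (h : n.term.children = [t, s]) :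
    ∃ c d, n.kids = [c, d] ∧ c.term = t ∧ d.term = s := by
  rw [← n.map_term_kids] at h
  match hk : n.kids, h with
  | [c, d], h => exact ⟨c, d, rfl, by simpa using h⟩

lemma _root_.ExpansionNets.Derivable.ne_star {G : Forest P X} (h : Derivable G) :
    ∀ r ∈ G, r.1 ≠ Term.star := by
  induction h with
  | exch F G hp _ ih => exact fun r hr => ih r (hp.mem_iff.2 hr)
  | axTop => simp
  | ax => simp
  | mix F G _ _ ih1 ih2 => exact fun r hr => (List.mem_append.1 hr).elim (ih1 r) (ih2 r)
  | or F t s A B _ ih =>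
    rintro r (_ | ⟨_, hr⟩)
    exacts [by simp, ih r (by simp [show r ∈ F from hr])]
  | or₀ F t A B _ ih =>
    rintro r (_ | ⟨_, hr⟩)
    exacts [by simp, ih r (by simp [show r ∈ F from hr])]
  | or₁ F t A B _ ih =>
    rintro r (_ | ⟨_, hr⟩)
    exacts [by simp, ih r (by simp [show r ∈ F from hr])]
  | and F G t s A B _ _ ih1 ih2 =>
    rintro r (_ | ⟨_, hr⟩)
    exacts [by simp, (List.mem_append.1 hr).elim (fun h => ih1 r (by simp [h]))
      fun h => ih2 r (by simp [h])]
  | contrAnd F ws vs us A B _ _ ih =>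
    rintro r (_ | ⟨_, hr⟩)
    exacts [by simp, ih r (by simp [show r ∈ F from hr])]
  | contrAtom F ws vs us a _ _ ih =>
    rintro r (_ | ⟨_, hr⟩)
    exacts [by simp, ih r (by simp [show r ∈ F from hr])]

/-- Contraction does not change the nodes representing a sequent. -/
lemma RepresentsForest.of_contraction {L : List F.Node} {G : Forest P X}
    {ws vs us : List (Term X)} {T : Typ P} (h : us.Perm (ws ++ vs))
    (hr : RepresentsForest L ((Term.sum us, T) :: G)) :
    RepresentsForest L ((Term.sum ws, T) :: (Term.sum vs, T) :: G) := by
  obtain ⟨ns, M, h1, h2, h3⟩ := hr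
  have h2 : ns.map Node.term = us := h2
  rw [← h2] at h
  obtain ⟨ms, hms, hp⟩ : ∃ ms : List F.Node, ms.map Node.term = ws ++ vs ∧ ns.Perm ms := by
    obtain ⟨ms, h4, h5⟩ := List.perm_comp_forall₂ (r := fun t n => t = Node.term n) h.symm
      (List.forall₂_map_left_iff.2 (List.forall₂_same.2 fun _ _ => rfl))
    refine ⟨ms, ?_, h5.symm⟩
    have h6 := List.forall₂_map_right_iff.2 h4
    rw [List.forall₂_eq_eq_eq] at h6
    exact h6.symm
  obtain ⟨m₁, m₂, rfl, h4, h5⟩ := List.map_eq_append_iff.1 hms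
  refine ⟨m₁, m₂ ++ M, ?_, h4, m₂, M, List.Perm.refl _, h5, h3⟩
  rw [← List.append_assoc]
  exact h1.trans (hp.append_right M)

/-- Soundness: nodes of a linear forest which represent a derivable sequent form a net. -/
theorem _root_.ExpansionNets.Derivable.isNet (hF : F.IsLinear) {G : Forest P X}
    (h : Derivable G) {L : List F.Node} (hL : RepresentsForest L G) (hd : IsDisjoint L) :
    IsNet L := by
  induction h generalizing L with
  | exch G H hp _ ih => exact ih (hL.exch hp.symm) hd
  | axTop =>
    obtain ⟨ns, M, h1, ⟨n, rfl, hn⟩, rfl⟩ := hL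
    refine .perm ?_ h1.symm
    have hU : nodesBelow [n] = insert n ∅ := by
      rw [nodesBelow_cons, nodesBelow_nil, Node.subtree_eq_singleton (by rw [hn]; rfl)]
      simp
    refine ⟨?_, ?_⟩
    · simp only [List.append_nil, hU]
      exact CuspGraph.noCycle_empty.insert (by simp)
    · simp only [List.append_nil, hU]
      exact WireClosed.insert_node (fun _ _ _ h => h.elim) (by simp [hn])
  | ax x p =>
    obtain ⟨ns, M, h1, h2, ms, N, h3, h4, rfl⟩ := hL
    obtain ⟨n, rfl, hn⟩ := List.map_eq_singleton_iff.1 h2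
    obtain ⟨m, rfl, hm⟩ := List.map_eq_singleton_iff.1 h4
    refine .perm ?_ (h1.trans (h3.append_left _)).symm
    have hU : nodesBelow ([n] ++ ([m] ++ [])) = insert n {m} := by
      simp only [List.append_nil, List.singleton_append]
      rw [nodesBelow_cons, nodesBelow_cons, nodesBelow_nil,
        Node.subtree_eq_singleton (by rw [hn]; rfl), Node.subtree_eq_singleton (by rw [hm]; rfl)]
      rw [Set.union_empty, Set.insert_eq]
    rw [← insert_empty_eq] at hU
    refine ⟨?_, ?_⟩
    · rw [hU]
      refine (CuspGraph.noCycle_empty.insert (by simp)).insert ?_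
      intro a ha b hb _ _
      exact Or.inl ((by simpa using ha : a = m).trans (by simpa using hb : b = m).symm)
    · rw [hU]
      rintro y i a (rfl | rfl | h) hy
      · rw [hn] at hy
        obtain ⟨rfl, rfl⟩ : x = y ∧ false = i := by simpa using hy
        exact ⟨m, by simp, hm⟩
      · rw [hm] at hy
        obtain ⟨rfl, rfl⟩ : x = y ∧ true = i := by simpa using hy
        exact ⟨n, by simp, hn⟩
      · exact h.elim
  | mix G H _ _ ih1 ih2 =>
    obtain ⟨L₁, L₂, hp, h1, h2⟩ := hL.append
    have hd' := hd.perm hp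
    obtain ⟨hd1, hd2, -⟩ := isDisjoint_append.1 hd'
    exact ((ih1 h1 hd1).append hF (ih2 h2 hd2) hd').perm hp.symm
  | or G t s A B hder ih =>
    obtain ⟨ns, M, hp, ⟨n, rfl, hn⟩, hM⟩ := hL
    have hd' : IsDisjoint (n :: M) := hd.perm hp
    obtain ⟨c, d, hk, rfl, rfl⟩ := kids_eq_pair (n := n) (by rw [hn]; rfl)
    have hsw : n.term.IsSwitched := by
      rw [hn]
      exact ⟨hder.ne_star (c.term, Typ.form A) (by simp), hder.ne_star (d.term, Typ.form B) (by simp)⟩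
    refine IsNet.perm (.of_switched hd' hsw ?_) hp.symm
    have hd1 : IsDisjoint (c :: d :: M) := by
      have := hd'.kids
      rwa [hk] at this
    have hp1 : (c :: (unfolded d ++ M)).Perm (unfolded d ++ c :: M) := List.perm_middle.symm
    have hd2 : IsDisjoint (d :: c :: M) := hd1.perm (List.Perm.swap _ _ _)
    have hd3 : IsDisjoint (c :: (unfolded d ++ M)) := hd2.unfolded.perm hp1.symm
    rw [hk]
    refine IsNet.perm (.of_unfolded hd2 (.perm (.of_unfolded hd3
      (ih hM.unfolded_cons.unfolded_cons hd3.unfolded)) hp1)) (List.Perm.swap _ _ _)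
  | or₀ G t A B _ ih =>
    obtain ⟨ns, M, hp, ⟨n, rfl, hn⟩, hM⟩ := hL
    have hd' : IsDisjoint (n :: M) := hd.perm hp
    obtain ⟨c, d, hk, rfl, hs⟩ := kids_eq_pair (n := n) (by rw [hn]; rfl)
    refine IsNet.perm (.of_star hd' (by simp [hn]) (.of_eq hk) hs ?_) hp.symm
    have hd1 : IsDisjoint (d :: c :: M) := by
      have := hd'.kids
      rw [hk] at this
      exact this.perm (List.Perm.swap _ _ _)
    have hd2 := (isDisjoint_cons.1 hd1).1
    exact .of_unfolded hd2 (ih hM.unfolded_cons hd2.unfolded)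
  | or₁ G t A B _ ih =>
    obtain ⟨ns, M, hp, ⟨n, rfl, hn⟩, hM⟩ := hL
    have hd' : IsDisjoint (n :: M) := hd.perm hp
    obtain ⟨d, c, hk, hs, rfl⟩ := kids_eq_pair (n := n) (by rw [hn]; rfl)
    refine IsNet.perm (.of_star hd' (by simp [hn]) (hk ▸ List.Perm.swap _ _ _) hs ?_) hp.symm
    have hd1 : IsDisjoint (d :: c :: M) := by
      have := hd'.kids
      rwa [hk] at this
    have hd2 := (isDisjoint_cons.1 hd1).1
    exact .of_unfolded hd2 (ih hM.unfolded_cons hd2.unfolded)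
  | and G H t s A B _ _ ih1 ih2 =>
    obtain ⟨ns, M, hp, h2, hM⟩ := hL
    obtain ⟨n, rfl, hn⟩ := List.map_eq_singleton_iff.1 h2
    obtain ⟨M₁, M₂, hp', hM1, hM2⟩ := hM.append
    have hp := hp.trans (hp'.append_left [n])
    have hd' : IsDisjoint (n :: (M₁ ++ M₂)) := hd.perm hp
    obtain ⟨c, d, hk, rfl, rfl⟩ := kids_eq_pair (n := n) (by rw [hn]; rfl)
    have hd1 : IsDisjoint ((c :: M₁) ++ (d :: M₂)) := by
      have := hd'.kids
      rw [hk] at this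
      exact this.perm ((List.perm_middle (l₁ := M₁)).symm.cons c)
    obtain ⟨hd2, hd3, -⟩ := isDisjoint_append.1 hd1
    exact IsNet.perm (.of_two hF hd' (by simp [hn]) hk
      (.of_unfolded hd2 (ih1 hM1.unfolded_cons hd2.unfolded))
      (.of_unfolded hd3 (ih2 hM2.unfolded_cons hd3.unfolded))) hp.symm
  | contrAnd G ws vs us A B h _ ih => exact ih (hL.of_contraction h) hd
  | contrAtom G ws vs us a h _ ih => exact ih (hL.of_contraction h) hd

/-- The roots of a forest, as nodes. -/
def roots (F : Forest P X) : List F.Node :=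
  (List.finRange F.length).map fun i : Fin F.length =>
    ⟨(i.1, []), by simp [Forest.termAt, Term.sub]⟩

lemma map_term_roots (F : Forest P X) : F.roots.map Node.term = F.map Prod.fst := by
  refine List.ext_getElem (by simp [roots]) fun k h1 h2 => ?_
  have hk : k < F.length := by simpa using h2
  have h : ∀ n : F.Node, n.1 = (k, []) → n.term = F[k].1 := by
    intro n hn
    have h := n.termAt_eq
    rw [hn] at h
    simpa [Forest.termAt, Term.sub, hk] using h.symm
  rw [List.getElem_map, List.getElem_map]
  exact h _ (by simp [roots])

lemma isDisjoint_roots (F : Forest P X) : IsDisjoint F.roots := by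
  rw [IsDisjoint, roots, List.pairwise_map]
  refine (List.nodup_finRange _).imp fun {k l} hkl => Set.disjoint_left.2 fun m hk hl => hkl ?_
  exact Fin.ext (hk.1.symm.trans hl.1)

lemma nodesBelow_roots (F : Forest P X) : nodesBelow F.roots = Set.univ := by
  refine Set.eq_univ_of_forall fun m => ?_
  have h := m.2
  have hi : m.1.1 < F.length := by
    have := Option.isSome_of_isSome_bind h
    simpa using this
  exact ⟨_, List.mem_map.2 ⟨⟨m.1.1, hi⟩, List.mem_finRange _, rfl⟩, rfl, List.nil_prefix⟩

lemma representsForest_flatMap_unfolded {L : List F.Node} {G : Forest P X}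
    (h : L.map Node.term = G.map Prod.fst) : RepresentsForest (L.flatMap unfolded) G := by
  induction G generalizing L with
  | nil =>
    obtain rfl : L = [] := by simpa using h
    rfl
  | cons r G ih =>
    match L, h with
    | n :: L, h =>
      obtain ⟨h1, h2⟩ := List.cons.inj h
      exact ⟨_, _, List.Perm.refl _, h1 ▸ represents_unfolded n, ih h2⟩

lemma isDisjoint_flatMap_unfolded {L M : List F.Node} (h : IsDisjoint (L ++ M)) :
    IsDisjoint (L.flatMap unfolded ++ M) := by
  induction L generalizing M with
  | nil => exact h
  | cons n L ih =>
    have h1 : IsDisjoint (n :: (L.flatMap unfolded ++ M)) :=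
      (ih (M := n :: M) (h.perm List.perm_middle.symm)).perm List.perm_middle
    simpa using h1.unfolded

lemma IsNet.of_flatMap_unfolded {L M : List F.Node} (hd : IsDisjoint (L ++ M))
    (h : IsNet (L.flatMap unfolded ++ M)) : IsNet (L ++ M) := by
  induction L generalizing M with
  | nil => exact h
  | cons n L ih =>
    have hd' : IsDisjoint (L ++ n :: M) := hd.perm List.perm_middle.symm
    refine IsNet.perm (ih hd' ?_) List.perm_middle
    refine IsNet.perm (.of_unfolded ((isDisjoint_flatMap_unfolded hd').perm List.perm_middle) ?_)
      List.perm_middle.symm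
    simpa using h

lemma _root_.ExpansionNets.Derivable.noCycle (hF : F.IsLinear) (h : Derivable F) :
    F.cuspGraph.NoCycle Set.univ := by
  have hd : IsDisjoint (F.roots ++ []) := by simpa using F.isDisjoint_roots
  have h1 := h.isNet hF (representsForest_flatMap_unfolded F.map_term_roots)
    (by simpa using isDisjoint_flatMap_unfolded hd)
  have h2 := (IsNet.of_flatMap_unfolded hd (by simpa using h1)).noCycle
  rwa [List.append_nil, nodesBelow_roots] at h2

end Forest

/-! ### AC-correct forests are derivable -/

namespace Forest

lemma WireClosed.of_insert {U : Set F.Node} {n : F.Node} (h : WireClosed (insert n U))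
    (hn : ∀ x, n.term ≠ Term.var x) : WireClosed U := by
  intro x i a ha hx
  obtain ⟨b, rfl | hb, hy⟩ := h x i a (Or.inr ha) hx
  · exact (hn _ hy).elim
  · exact ⟨b, hb, hy⟩

/-- The steps of paths within `U` that avoid `n`. -/
def StepAvoiding (U : Set F.Node) (n a b : F.Node) : Prop :=
  F.cuspGraph.Adj a b ∧ a ∈ U ∧ b ∈ U ∧ a ≠ n ∧ b ≠ n

lemma StepAvoiding.symm {U : Set F.Node} {n a b : F.Node} (h : StepAvoiding U n a b) :
    StepAvoiding U n b a :=
  ⟨F.cuspGraph.symm h.1, h.2.2.1, h.2.1, h.2.2.2.2, h.2.2.2.1⟩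

/-- The splitting tensor: if all roots of a sub-forest without cusp-free cycles are wire variables
and tensors, with at least one tensor, then the two successors of one of these tensors are not
connected without it. -/
lemma exists_splitting_tensor (hc : F.cuspGraph.NoCycle Set.univ) {L : List F.Node}
    (hL : ∀ n ∈ L, (∃ x, n.term = Term.var x) ∨ ∃ t s, n.term = Term.tensor t s)
    (hex : ∃ n ∈ L, ∃ t s, n.term = Term.tensor t s) :
    ∃ n ∈ L, ∃ c d, n.kids = [c, d] ∧
      ¬ Relation.ReflTransGen (StepAvoiding (nodesBelow L) n) c d := by
  obtain ⟨c, b, ⟨hcU, hcb⟩, hroot, hsplit⟩ := (hc.induce (nodesBelow L)).exists_splitting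
    (fun c b => c ∈ nodesBelow L ∧ c.IsSucc b)
    (fun h => ⟨Or.inr (Or.inl h.2), h.1, mem_nodesBelow_of_isSucc h.2 h.1⟩)
    (fun h => h.2.ne) (fun h h' => h.2.asymm h'.2)
    (fun h e hce => hce.resolve_right fun h' => h.2.asymm h'.2.2)
    (fun hadj h hne => ⟨hadj.2.1, (h.resolve_left hne).2.1⟩)
    (by
      obtain ⟨n, hn, t, s, ht⟩ := hex
      obtain ⟨c, d, hk, -, -⟩ := kids_eq_pair (n := n) (by rw [ht]; rfl)
      exact ⟨n, c, mem_nodesBelow_of_mem hn, Node.mem_kids.1 (by simp [hk])⟩)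
  have hcL : c ∈ L := by
    obtain ⟨m, hm, hcm⟩ := hcU
    by_cases h : c = m
    · exact h ▸ hm
    · obtain ⟨a, ha, hac⟩ := Node.exists_isSucc_of_mem_subtree hcm h
      exact (hroot a ⟨⟨m, hm, ha⟩, hac⟩).elim
  obtain ⟨t, s, ht⟩ : ∃ t s, c.term = Term.tensor t s :=
    (hL c hcL).resolve_left fun ⟨x, hx⟩ => Node.not_isSucc_of_var hx hcb
  obtain ⟨x, y, hk, -, -⟩ := kids_eq_pair (n := c) (by rw [ht]; rfl)
  have hx : c.IsSucc x := Node.mem_kids.1 (by simp [hk])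
  have hy : c.IsSucc y := Node.mem_kids.1 (by simp [hk])
  have hxy : x ≠ y := by
    have := c.pairwise_disjoint_kids
    rw [hk] at this
    rintro rfl
    exact Set.disjoint_left.1 (by simpa using this : Disjoint x.subtree x.subtree)
      x.self_mem_subtree x.self_mem_subtree
  have hcusp : ∀ {a b}, a ≠ b → ¬ F.cuspGraph.Cusp c a b := by
    rintro a b hab (h | ⟨h, -⟩)
    · exact hab h
    · rw [ht] at h
      exact h
  have hmono : ∀ {a b}, Relation.ReflTransGen (StepAvoiding (nodesBelow L) c) a b →
      Relation.ReflTransGen (fun a b => ((F.cuspGraph.induce (nodesBelow L)).Adj a b ∧ b ≠ c))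
        a b := fun {a b} =>
    Relation.ReflTransGen.mono (fun _ _ h => ⟨⟨h.1, h.2.1, h.2.2.1⟩, h.2.2.2.2⟩) a b
  have hadj : ∀ {a}, c.IsSucc a → (F.cuspGraph.induce (nodesBelow L)).Adj c a := fun h =>
    ⟨Or.inr (Or.inl h), hcU, mem_nodesBelow_of_isSucc h hcU⟩
  refine ⟨c, hcL, x, y, hk, fun hcon => ?_⟩
  have hb : b = x ∨ b = y := by simpa [hk] using Node.mem_kids.2 hcb
  rcases hb with rfl | rfl
  · have : Std.Symm (StepAvoiding (nodesBelow L) c) := ⟨fun _ _ h => h.symm⟩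
    exact hsplit y (hadj hy) hy.ne.symm (hcusp hxy.symm) (hmono (Std.Symm.symm _ _ hcon))
  · exact hsplit x (hadj hx) hx.ne.symm (hcusp hxy) (hmono hcon)

lemma reflTransGen_of_mem_subtree {U : Set F.Node} {n m z : F.Node} (hU : m.subtree ⊆ U)
    (hn : n ∉ m.subtree) (hz : z ∈ m.subtree) :
    Relation.ReflTransGen (StepAvoiding U n) m z := by
  suffices H : ∀ k z, z ∈ m.subtree → z.1.2.length = k →
      Relation.ReflTransGen (StepAvoiding U n) m z from H _ z hz rfl
  intro k
  induction k with
  | zero =>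
    intro z hz hk
    by_cases h : z = m
    · exact h ▸ .refl
    · obtain ⟨a, -, ha⟩ := Node.exists_isSucc_of_mem_subtree hz h
      have := ha.length
      omega
  | succ k ih =>
    intro z hz hk
    by_cases h : z = m
    · exact h ▸ .refl
    · obtain ⟨a, ham, ha⟩ := Node.exists_isSucc_of_mem_subtree hz h
      refine (ih a ham (by have := ha.length; omega)).tail
        ⟨Or.inr (Or.inl ha), hU ham, hU hz, ?_, ?_⟩
      · rintro rfl; exact hn ham
      · rintro rfl; exact hn hz

/-- The root of a sequent given by a node of a forest, with its type. A tree represents itself, and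
a witness `w` represents the expansion `(w)`. -/
def sequentRoot (r : F.Node × Typ P) : Term X × Typ P :=
  match r.2 with
  | Typ.form A => (r.1.term, Typ.form A)
  | Typ.wAtom a => (Term.sum [r.1.term], Typ.form (Formula.atom a))
  | Typ.wTensor A B => (Term.sum [r.1.term], Typ.form (Formula.and A B))

/-- The list consists of typed nodes with disjoint subtrees, which together are closed under duality
of wire variables. -/
structure IsTypedList (τ : X → Option P) (L : List (F.Node × Typ P)) : Prop where
  disjoint : IsDisjoint (L.map Prod.fst)
  wireClosed : WireClosed (nodesBelow (L.map Prod.fst))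
  typed : ∀ r ∈ L, HasType τ r.1.term r.2

variable {τ : X → Option P}

lemma IsTypedList.perm {L M : List (F.Node × Typ P)} (h : IsTypedList τ L) (hp : L.Perm M) :
    IsTypedList τ M :=
  ⟨h.disjoint.perm (hp.map _), nodesBelow_perm (hp.map Prod.fst) ▸ h.wireClosed,
    fun r hr => h.typed r (hp.mem_iff.2 hr)⟩

/-- The total size of the terms at the nodes in a list. -/
noncomputable def totalSize (L : List (F.Node × Typ P)) : ℕ := (L.map fun r => sizeOf r.1.term).sum

lemma totalSize_perm {L M : List (F.Node × Typ P)} (hp : L.Perm M) :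
    totalSize L = totalSize M := (hp.map _).sum_eq

lemma totalSize_cons (r : F.Node × Typ P) (L : List (F.Node × Typ P)) :
    totalSize (r :: L) = sizeOf r.1.term + totalSize L := by simp [totalSize]

lemma totalSize_append (L M : List (F.Node × Typ P)) :
    totalSize (L ++ M) = totalSize L + totalSize M := by simp [totalSize]

lemma _root_.ExpansionNets.Term.sizeOf_pos (t : Term X) : 0 < sizeOf t := by
  cases t <;> simp

lemma _root_.ExpansionNets.Term.sum_sizeOf_children (t : Term X) :
    (t.children.map sizeOf).sum < sizeOf t := by
  cases t with
  | sum ws =>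
    simp only [Term.children, Term.sum.sizeOf_spec]
    have : (ws.map sizeOf).sum ≤ sizeOf ws := by
      induction ws with
      | nil => simp
      | cons w ws ih =>
        simp only [List.map_cons, List.sum_cons, List.cons.sizeOf_spec]
        omega
    omega
  | _ => simp [Term.children]

lemma totalSize_kids (n : F.Node) (T : Typ P) :
    totalSize (n.kids.map fun c => (c, T)) < sizeOf n.term := by
  have h := n.term.sum_sizeOf_children
  rw [← n.map_term_kids, List.map_map] at h
  simpa [totalSize, Function.comp_def] using h

lemma derivable_sum {C : Typ P}
    (hcontr : ∀ (G : Forest P X) (ws vs us : List (Term X)), us.Perm (ws ++ vs) →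
      Derivable ((Term.sum ws, C) :: (Term.sum vs, C) :: G) → Derivable ((Term.sum us, C) :: G))
    {ws : List (Term X)} (hne : ws ≠ []) {G : Forest P X}
    (h : Derivable (ws.map (fun w => (Term.sum [w], C)) ++ G)) :
    Derivable ((Term.sum ws, C) :: G) := by
  induction ws generalizing G with
  | nil => exact (hne rfl).elim
  | cons w ws ih =>
    match ws, h, ih with
    | [], h, _ => exact h
    | v :: ws, h, ih =>
      refine hcontr G (v :: ws) [w] _ (List.perm_append_comm (l₁ := [w])) ?_
      exact ih (by simp) (h.exch _ _ List.perm_middle.symm)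

lemma derivable_append {L M : List (F.Node × Typ P)} (h : Derivable (L.map sequentRoot))
    (h' : M ≠ [] → Derivable (M.map sequentRoot)) : Derivable ((L ++ M).map sequentRoot) := by
  by_cases hM : M = []
  · simpa [hM] using h
  · rw [List.map_append]
    exact h.mix _ _ (h' hM)

/-- If the successors of the tensor `n` are not connected without it, then the other roots can be
distributed over the two successors. -/
lemma exists_split {n c d : F.Node} {T A B : Typ P}
    {M : List (F.Node × Typ P)} (h : IsTypedList τ ((n, T) :: M)) (hn : ∀ x, n.term ≠ Term.var x)
    (hk : n.kids = [c, d]) (hc : HasType τ c.term A) (hd : HasType τ d.term B)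
    (hsplit : ¬ Relation.ReflTransGen
      (StepAvoiding (nodesBelow (((n, T) :: M).map Prod.fst)) n) c d) :
    ∃ M₁ M₂, M.Perm (M₁ ++ M₂) ∧ IsTypedList τ ((c, A) :: M₁) ∧ IsTypedList τ ((d, B) :: M₂) := by
  classical
  let U := nodesBelow (((n, T) :: M).map Prod.fst)
  let K : Set F.Node := {z | Relation.ReflTransGen (StepAvoiding U n) c z}
  let M₁ := M.filter fun r => r.1 ∈ K
  let M₂ := M.filter fun r => ¬ r.1 ∈ K
  have hM : M.Perm (M₁ ++ M₂) := by
    have := List.filter_append_perm (fun r : F.Node × Typ P => decide (r.1 ∈ K)) M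
    simpa [M₁, M₂] using this.symm
  have hdis : IsDisjoint (n :: M.map Prod.fst) := h.disjoint
  have hp : (n.kids ++ M.map Prod.fst).Perm
      ((c :: M₁.map Prod.fst) ++ (d :: M₂.map Prod.fst)) := by
    rw [hk]
    refine ((hM.map Prod.fst).append_left [c, d]).trans ?_
    rw [List.map_append]
    exact (List.perm_middle (l₁ := M₁.map Prod.fst)).symm.cons c
  have hU : U = insert n
      (nodesBelow (c :: M₁.map Prod.fst) ∪ nodesBelow (d :: M₂.map Prod.fst)) := by
    rw [← nodesBelow_append, ← nodesBelow_perm hp, ← nodesBelow_cons_kids]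
    rfl
  have hdis' := hdis.kids.perm hp
  obtain ⟨hd1, hd2, -⟩ := isDisjoint_append.1 hdis'
  have hnU : n ∉ nodesBelow (c :: M₁.map Prod.fst) ∪ nodesBelow (d :: M₂.map Prod.fst) := by
    rw [← nodesBelow_append, ← nodesBelow_perm hp, nodesBelow_append]
    rintro (⟨k, hk', hm⟩ | hm)
    · exact Node.notMem_subtree_of_isSucc (Node.mem_kids.1 hk') hm
    · exact Set.disjoint_left.1 (isDisjoint_cons.1 hdis).2 n.self_mem_subtree hm
  -- Subtrees lie on one side.
  have hside : ∀ m, m.subtree ⊆ nodesBelow (c :: M₁.map Prod.fst) ∪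
      nodesBelow (d :: M₂.map Prod.fst) → ∀ z ∈ m.subtree,
      Relation.ReflTransGen (StepAvoiding U n) m z := fun m hm z hz =>
    reflTransGen_of_mem_subtree (hm.trans (hU ▸ Set.subset_insert _ _)) (fun h => hnU (hm h)) hz
  have hsymm : Std.Symm (StepAvoiding U n) := ⟨fun _ _ h => h.symm⟩
  have hW1 : ∀ z ∈ nodesBelow (c :: M₁.map Prod.fst), z ∈ K := by
    rintro z ⟨m, hm, hz⟩
    have hmz := hside m (fun y hy => Or.inl ⟨m, hm, hy⟩) z hz
    have hmK : m ∈ K := by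
      rcases List.mem_cons.1 hm with rfl | hm
      · exact Relation.ReflTransGen.refl
      · obtain ⟨r, hr, rfl⟩ := List.mem_map.1 hm
        simpa using (List.mem_filter.1 hr).2
    exact Relation.ReflTransGen.trans hmK hmz
  have hW2 : ∀ z ∈ nodesBelow (d :: M₂.map Prod.fst), z ∉ K := by
    rintro z ⟨m, hm, hz⟩ hzK
    have hmz := hside m (fun y hy => Or.inr ⟨m, hm, hy⟩) z hz
    have hmK : m ∈ K := Relation.ReflTransGen.trans hzK (Std.Symm.symm _ _ hmz)
    rcases List.mem_cons.1 hm with rfl | hm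
    · exact hsplit hmK
    · obtain ⟨r, hr, rfl⟩ := List.mem_map.1 hm
      have := (List.mem_filter.1 hr).2
      simp only [decide_not, Bool.not_eq_true', decide_eq_false_iff_not] at this
      exact this hmK
  have hcl := h.wireClosed
  have hwire : ∀ (x : X) (i : Bool), ∀ a ∈ U, a.term = Term.var (x, i) →
      ∃ b ∈ U, b.term = Term.var (x, !i) ∧ StepAvoiding U n a b := by
    intro x i a ha hx
    obtain ⟨b, hb, hy⟩ := hcl x i a ha hx
    refine ⟨b, hb, hy, ?_, ha, hb, ?_, ?_⟩
    · cases i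
      · exact Or.inr (Or.inr ⟨x, hy, hx⟩)
      · exact Or.inl (Or.inr ⟨x, hx, hy⟩)
    · rintro rfl; exact hn _ hx
    · rintro rfl; exact hn _ hy
  refine ⟨M₁, M₂, hM, ⟨hd1, ?_, ?_⟩, ⟨hd2, ?_, ?_⟩⟩
  · intro x i a ha hx
    obtain ⟨b, hb, hy, hab⟩ := hwire x i a (hU ▸ Or.inr (Or.inl ha)) hx
    refine ⟨b, ?_, hy⟩
    rw [hU] at hb
    rcases hb with rfl | hb | hb
    · exact (hn _ hy).elim
    · exact hb
    · exact (hW2 b hb (Relation.ReflTransGen.tail (hW1 a ha) hab)).elim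
  · intro r hr
    rcases List.mem_cons.1 hr with rfl | hr
    · exact hc
    · exact h.typed r (List.mem_cons_of_mem _ (List.mem_filter.1 hr).1)
  · intro x i a ha hx
    obtain ⟨b, hb, hy, hab⟩ := hwire x i a (hU ▸ Or.inr (Or.inr ha)) hx
    refine ⟨b, ?_, hy⟩
    rw [hU] at hb
    rcases hb with rfl | hb | hb
    · exact (hn _ hy).elim
    · exact (hW2 a ha (Relation.ReflTransGen.tail (hW1 b hb) hab.symm)).elim
    · exact hb
  · intro r hr
    rcases List.mem_cons.1 hr with rfl | hr
    · exact hd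
    · exact h.typed r (List.mem_cons_of_mem _ (List.mem_filter.1 hr).1)

lemma IsTypedList.tail_of_one {n : F.Node} {T : Typ P} {M : List (F.Node × Typ P)}
    (h : IsTypedList τ ((n, T) :: M)) (hk : n.kids = []) (hn : ∀ x, n.term ≠ Term.var x) :
    IsTypedList τ M := by
  refine ⟨(isDisjoint_cons.1 h.disjoint).1, ?_, fun r hr => h.typed r (List.mem_cons_of_mem _ hr)⟩
  have := h.wireClosed
  rw [List.map_cons, nodesBelow_cons_kids, hk] at this
  exact this.of_insert hn

/-- Replacing a root by its successors. -/
lemma IsTypedList.kids {n : F.Node} {T : Typ P} {M N : List (F.Node × Typ P)}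
    (h : IsTypedList τ ((n, T) :: M)) (hn : ∀ x, n.term ≠ Term.var x)
    (hN : N.map Prod.fst = n.kids) (hT : ∀ r ∈ N, HasType τ r.1.term r.2) :
    IsTypedList τ (N ++ M) := by
  have hd : IsDisjoint (n :: M.map Prod.fst) := h.disjoint
  have hw : WireClosed (nodesBelow (n :: M.map Prod.fst)) := h.wireClosed
  rw [nodesBelow_cons_kids] at hw
  refine ⟨?_, ?_, fun r hr => ?_⟩
  · rw [List.map_append, hN]
    exact hd.kids
  · rw [List.map_append, hN]
    exact hw.of_insert hn
  · rcases List.mem_append.1 hr with hr | hr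
    · exact hT r hr
    · exact h.typed r (List.mem_cons_of_mem _ hr)

/-- Replacing a default weakening by its proper successor. -/
lemma IsTypedList.of_star {n c s : F.Node} {T A : Typ P} {M : List (F.Node × Typ P)}
    (h : IsTypedList τ ((n, T) :: M)) (hn : ∀ x, n.term ≠ Term.var x)
    (hk : n.kids.Perm [s, c]) (hs : s.term = Term.star) (hc : HasType τ c.term A) :
    IsTypedList τ ((c, A) :: M) := by
  have hd : IsDisjoint (n :: M.map Prod.fst) := h.disjoint
  have hw : WireClosed (nodesBelow (n :: M.map Prod.fst)) := h.wireClosed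
  rw [nodesBelow_cons_kids] at hw
  have hd1 : IsDisjoint (s :: c :: M.map Prod.fst) := hd.kids.perm (hk.append_right _)
  have hw1 := hw.of_insert hn
  have hkid : s.kids = [] := by
    have := s.map_term_kids
    rw [hs] at this
    simpa [Term.children] using this
  rw [nodesBelow_perm (hk.append_right _), List.cons_append, nodesBelow_cons_kids, hkid] at hw1
  refine ⟨(isDisjoint_cons.1 hd1).1, hw1.of_insert (by simp [hs]), fun r hr => ?_⟩
  rcases List.mem_cons.1 hr with rfl | hr
  · exact hc
  · exact h.typed r (List.mem_cons_of_mem _ hr)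

/-- Removing an axiom. -/
lemma IsTypedList.tail_of_axiom (hlin : F.IsLinear) {n m : F.Node} {S T : Typ P} {x : X} {i : Bool}
    {M : List (F.Node × Typ P)} (h : IsTypedList τ ((n, S) :: (m, T) :: M))
    (hn : n.term = Term.var (x, i)) (hm : m.term = Term.var (x, !i)) : IsTypedList τ M := by
  have hd : IsDisjoint (n :: m :: M.map Prod.fst) := h.disjoint
  obtain ⟨hd1, hd2⟩ := isDisjoint_cons.1 hd
  obtain ⟨hd3, hd4⟩ := isDisjoint_cons.1 hd1
  refine ⟨hd3, ?_, fun r hr => h.typed r (by simp [hr])⟩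
  have hnM : n ∉ nodesBelow (M.map Prod.fst) := fun hm' =>
    Set.disjoint_left.1 hd2 n.self_mem_subtree (by rw [nodesBelow_cons]; exact Or.inr hm')
  have hmM : m ∉ nodesBelow (M.map Prod.fst) := fun hm' =>
    Set.disjoint_left.1 hd4 m.self_mem_subtree hm'
  intro y j a ha hy
  obtain ⟨b, hb, hb'⟩ := h.wireClosed y j a
    (by rw [List.map_cons, List.map_cons, nodesBelow_cons, nodesBelow_cons]
        exact Or.inr (Or.inr ha)) hy
  rw [List.map_cons, List.map_cons, nodesBelow_cons, nodesBelow_cons,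
    Node.subtree_eq_singleton (by rw [hn]; rfl), Node.subtree_eq_singleton (by rw [hm]; rfl)] at hb
  rcases hb with rfl | rfl | hb
  · rw [hn] at hb'
    obtain ⟨rfl, rfl⟩ : x = y ∧ i = !j := by simpa using hb'
    rw [Bool.not_not] at hm
    exact (hmM (hlin _ _ _ hm hy ▸ ha)).elim
  · rw [hm] at hb'
    obtain ⟨rfl, rfl⟩ : x = y ∧ i = j := by simpa using hb'
    exact (hnM (hlin _ _ _ hn hy ▸ ha)).elim
  · exact ⟨b, hb, hb'⟩

/-- Sequentialization: a nonempty list of typed nodes in a linear forest without cusp-free cycles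
gives a derivable sequent. -/
theorem IsTypedList.derivable (hlin : F.IsLinear) (hcyc : F.cuspGraph.NoCycle Set.univ)
    {L : List (F.Node × Typ P)} (hne : L ≠ []) (hL : IsTypedList τ L) :
    Derivable (L.map sequentRoot) := by
  suffices H : ∀ k (L : List (F.Node × Typ P)), totalSize L = k → L ≠ [] → IsTypedList τ L →
      Derivable (L.map sequentRoot) from H _ L rfl hne hL
  clear hne hL L
  intro k
  induction k using Nat.strong_induction_on with
  | _ k ih =>
  intro L hk hne hL
  have ih : ∀ M : List (F.Node × Typ P), totalSize M < k → M ≠ [] → IsTypedList τ M →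
      Derivable (M.map sequentRoot) := fun M h => ih _ h M rfl
  by_cases hform : ∃ r ∈ L, ∃ A, r.2 = Typ.form A
  · obtain ⟨⟨n, T⟩, hr, A, hA⟩ := hform
    obtain rfl : T = Typ.form A := hA
    obtain ⟨l₁, l₂, hl⟩ := List.append_of_mem hr
    have hp : L.Perm ((n, Typ.form A) :: (l₁ ++ l₂)) := hl ▸ List.perm_middle
    generalize l₁ ++ l₂ = M at hp
    replace hL := hL.perm hp
    rw [totalSize_perm hp, totalSize_cons] at hk
    refine Derivable.exch _ _ (hp.symm.map _) ?_
    have hT : HasType τ n.term (Typ.form A) := hL.typed (n, Typ.form A) (by simp)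
    have hpos := n.term.sizeOf_pos
    have hkids := n.map_term_kids
    have hsize := n.term.sum_sizeOf_children
    have hLsum : ∀ T : Typ P, (∀ c ∈ n.kids, HasType τ c.term T) →
        (∀ x, n.term ≠ Term.var x) → n.kids ≠ [] →
        Derivable (((n.kids.map fun c => (c, T)) ++ M).map sequentRoot) := by
      intro T hT hn hne
      have h1 : IsTypedList τ ((n.kids.map fun c => (c, T)) ++ M) := by
        refine hL.kids hn (by simp [Function.comp_def]) ?_
        intro r hr
        obtain ⟨c, hc, rfl⟩ := List.mem_map.1 hr
        exact hT c hc
      refine ih _ ?_ (by simp [hne]) h1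
      have := totalSize_kids n T
      rw [totalSize_append]
      simp only at hk
      omega
    have hroot : sequentRoot (n, Typ.form A) = (n.term, Typ.form A) := rfl
    rw [List.map_cons, hroot]
    generalize ht : n.term = t at hT
    simp only [ht] at hk hpos hkids hsize
    cases hT with
    | one =>
      have hM : IsTypedList τ M := hL.tail_of_one (by simpa [Term.children] using hkids)
        (by simp [ht])
      have h1 : Derivable ([(n, Typ.form Formula.top)].map sequentRoot) := by
        have : sequentRoot (n, Typ.form Formula.top) = (Term.one, Typ.form Formula.top) := by
          rw [← ht]; rfl
        rw [List.map_singleton, this]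
        exact Derivable.axTop
      have h2 := derivable_append h1 fun hne => ih M (by omega) hne hM
      have h3 : ([(n, Typ.form Formula.top)] ++ M).map sequentRoot =
          (n.term, Typ.form Formula.top) :: M.map sequentRoot := rfl
      rwa [h3, ht] at h2
    | or t s A B hA hB =>
      obtain ⟨c, d, hkd, rfl, rfl⟩ := kids_eq_pair (n := n) (by rw [ht]; rfl)
      refine Derivable.or _ _ _ _ _ (ih ((c, Typ.form A) :: (d, Typ.form B) :: M) ?_ (by simp) ?_)
      · simp only [totalSize_cons]
        simp [Term.children] at hsize
        simp at hk
        omega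
      · refine hL.kids (N := [(c, Typ.form A), (d, Typ.form B)]) (by simp [ht]) (by simp [hkd]) ?_
        simpa using ⟨hA, hB⟩
    | orStar t A B hA =>
      obtain ⟨c, d, hkd, rfl, hd⟩ := kids_eq_pair (n := n) (by rw [ht]; rfl)
      refine Derivable.or₀ _ _ _ _ (ih ((c, Typ.form A) :: M) ?_ (by simp) ?_)
      · simp only [totalSize_cons]
        simp [Term.children] at hsize
        simp at hk
        omega
      · exact hL.of_star (by simp [ht]) (hkd ▸ List.Perm.swap _ _ _) hd hA
    | starOr s A B hB =>
      obtain ⟨c, d, hkd, hc, rfl⟩ := kids_eq_pair (n := n) (by rw [ht]; rfl)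
      refine Derivable.or₁ _ _ _ _ (ih ((d, Typ.form B) :: M) ?_ (by simp) ?_)
      · simp only [totalSize_cons]
        simp [Term.children] at hsize
        simp at hk
        omega
      · exact hL.of_star (by simp [ht]) (.of_eq hkd) hc hB
    | sumAtom ws a hne hw =>
      refine derivable_sum (fun G ws vs us h => Derivable.contrAtom G ws vs us a h) hne ?_
      have hws : n.kids.map Node.term = ws := hkids
      have h1 := hLsum (Typ.wAtom a) (fun c hc => hw _ (hws ▸ List.mem_map_of_mem hc))
        (by simp [ht]) (fun h => hne (by rw [← hws, h]; rfl))
      rw [List.map_append, List.map_map] at h1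
      rw [← hws, List.map_map]
      exact h1
    | sumAnd ws A B hne hw =>
      refine derivable_sum (fun G ws vs us h => Derivable.contrAnd G ws vs us A B h) hne ?_
      have hws : n.kids.map Node.term = ws := hkids
      have h1 := hLsum (Typ.wTensor A B) (fun c hc => hw _ (hws ▸ List.mem_map_of_mem hc))
        (by simp [ht]) (fun h => hne (by rw [← hws, h]; rfl))
      rw [List.map_append, List.map_map] at h1
      rw [← hws, List.map_map]
      exact h1
  · -- All roots are witnesses.
    have hwit : ∀ r ∈ L, (∃ x i p, r.1.term = Term.var (x, i) ∧ r.2 = Typ.wAtom (p, i) ∧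
        τ x = some p) ∨ ∃ c d A B, r.1.kids = [c, d] ∧ r.1.term = Term.tensor c.term d.term ∧
        r.2 = Typ.wTensor A B ∧ HasType τ c.term (Typ.form A) ∧ HasType τ d.term (Typ.form B) := by
      intro r hr
      have hT := hL.typed r hr
      have hnf : ∀ A, r.2 ≠ Typ.form A := fun A hA => hform ⟨r, hr, A, hA⟩
      generalize ht : r.1.term = t at hT
      generalize hS : r.2 = S at hT
      cases hT with
      | var x i p h => exact Or.inl ⟨x, i, p, rfl, rfl, h⟩
      | tensor t s A B hA hB =>
        obtain ⟨c, d, hkd, rfl, rfl⟩ := kids_eq_pair (n := r.1) (by rw [ht]; rfl)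
        exact Or.inr ⟨c, d, A, B, hkd, rfl, rfl, hA, hB⟩
      | _ => exact (hnf _ hS).elim
    by_cases hax : ∃ r ∈ L, ∃ s ∈ L, ∃ x, r.1.term = Term.var (x, false) ∧
        s.1.term = Term.var (x, true)
    · obtain ⟨r, hr, s, hs, x, hrx, hsx⟩ := hax
      obtain ⟨l₁, l₂, rfl⟩ := List.append_of_mem hr
      have hs' : s ∈ l₁ ++ l₂ := by
        have : s ≠ r := by
          rintro rfl
          rw [hrx] at hsx
          simp at hsx
        simpa [this] using hs
      obtain ⟨m₁, m₂, hm⟩ := List.append_of_mem hs'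
      have hp : (l₁ ++ r :: l₂).Perm (r :: s :: (m₁ ++ m₂)) :=
        List.perm_middle.trans ((hm ▸ List.perm_middle : (l₁ ++ l₂).Perm _).cons r)
      have hr2 : ∃ p, r.2 = Typ.wAtom (p, false) ∧ τ x = some p := by
        rcases hwit r hr with ⟨y, i, p, h1, h2, h3⟩ | ⟨c, d, A, B, -, h1, -⟩
        · rw [hrx] at h1
          obtain ⟨rfl, rfl⟩ : x = y ∧ false = i := by simpa using h1
          exact ⟨p, h2, h3⟩
        · simp [hrx] at h1
      have hs2 : ∃ p, s.2 = Typ.wAtom (p, true) ∧ τ x = some p := by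
        rcases hwit s hs with ⟨y, i, p, h1, h2, h3⟩ | ⟨c, d, A, B, -, h1, -⟩
        · rw [hsx] at h1
          obtain ⟨rfl, rfl⟩ : x = y ∧ true = i := by simpa using h1
          exact ⟨p, h2, h3⟩
        · simp [hsx] at h1
      obtain ⟨p, hrp, hp1⟩ := hr2
      obtain ⟨q, hsq, hp2⟩ := hs2
      obtain rfl : p = q := Option.some.inj (hp1.symm.trans hp2)
      refine Derivable.exch _ _ (hp.symm.map _) ?_
      have hM : IsTypedList τ (m₁ ++ m₂) :=
        IsTypedList.tail_of_axiom (n := r.1) (m := s.1) hlin (hL.perm hp) hrx hsx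
      rw [totalSize_perm hp, totalSize_cons, totalSize_cons] at hk
      have := r.1.term.sizeOf_pos
      refine derivable_append (L := [r, s]) (M := m₁ ++ m₂) ?_ fun hne => ih _ (by omega) hne hM
      have e1 : sequentRoot r =
          (Term.sum [Term.var (x, false)], Typ.form (Formula.atom (p, false))) := by
        rw [← hrx]; unfold sequentRoot; rw [hrp]
      have e2 : sequentRoot s =
          (Term.sum [Term.var (x, true)], Typ.form (Formula.atom (p, true))) := by
        rw [← hsx]; unfold sequentRoot; rw [hsq]
      rw [List.map_cons, List.map_singleton, e1, e2]
      exact Derivable.ax x p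
    · have hvar : ∀ r ∈ L, ∀ x i, r.1.term = Term.var (x, i) → ∀ s ∈ L,
          s.1.term ≠ Term.var (x, !i) := by
        intro r hr x i hx s hs hy
        cases i
        · exact hax ⟨r, hr, s, hs, x, hx, hy⟩
        · exact hax ⟨s, hs, r, hr, x, hy, hx⟩
      -- The dual of a wire variable at a root lies strictly above a root, which is a tensor.
      have htens : ∃ r ∈ L, ∃ t s, r.1.term = Term.tensor t s := by
        obtain ⟨r, hr⟩ := List.exists_mem_of_ne_nil L hne
        rcases hwit r hr with ⟨x, i, p, hx, -, -⟩ | ⟨c, d, A, B, -, h, -⟩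
        · obtain ⟨b, ⟨m, hm, hb⟩, hy⟩ := hL.wireClosed x i r.1
            (mem_nodesBelow_of_mem (List.mem_map_of_mem hr)) hx
          obtain ⟨s, hs, rfl⟩ := List.mem_map.1 hm
          rcases hwit s hs with ⟨y, j, q, hs', -, -⟩ | ⟨c, d, A, B, -, h, -⟩
          · rw [Node.subtree_eq_singleton (by rw [hs']; rfl)] at hb
            obtain rfl : b = s.1 := hb
            exact (hvar r hr x i hx s hs hy).elim
          · exact ⟨s, hs, _, _, h⟩
        · exact ⟨r, hr, _, _, h⟩
      obtain ⟨n, hn, c, d, hkd, hsplit⟩ := exists_splitting_tensor hcyc (L := L.map Prod.fst)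
        (fun n hn => by
          obtain ⟨r, hr, rfl⟩ := List.mem_map.1 hn
          rcases hwit r hr with ⟨x, i, p, hx, -, -⟩ | ⟨c, d, A, B, -, h, -⟩
          exacts [Or.inl ⟨_, hx⟩, Or.inr ⟨_, _, h⟩])
        (by
          obtain ⟨r, hr, h⟩ := htens
          exact ⟨r.1, List.mem_map_of_mem hr, h⟩)
      obtain ⟨⟨n, T⟩, hr, rfl⟩ := List.mem_map.1 hn
      rcases hwit _ hr with ⟨x, i, p, hx, -, -⟩ | ⟨c', d', A, B, hkd', ht, rfl, hA, hB⟩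
      · exact (Node.not_isSucc_of_var hx (Node.mem_kids.1 (by simp [hkd] : c ∈ _))).elim
      · rw [hkd] at hkd'
        obtain ⟨rfl, rfl⟩ : c = c' ∧ d = d' := by simpa using hkd'
        obtain ⟨l₁, l₂, hl⟩ := List.append_of_mem hr
        have hp : L.Perm ((n, Typ.wTensor A B) :: (l₁ ++ l₂)) := hl ▸ List.perm_middle
        generalize l₁ ++ l₂ = M at hp
        rw [nodesBelow_perm (hp.map Prod.fst)] at hsplit
        obtain ⟨M₁, M₂, hM, h1, h2⟩ :=
          exists_split (hL.perm hp) (fun x hx => by simp [hx] at ht) hkd hA hB hsplit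
        have hp' := hp.trans (hM.cons _)
        rw [totalSize_perm hp', totalSize_cons, totalSize_append] at hk
        simp only [ht, Term.tensor.sizeOf_spec] at hk
        have hpos := c.term.sizeOf_pos
        have hpos' := d.term.sizeOf_pos
        have d1 := ih ((c, Typ.form A) :: M₁) (by simp only [totalSize_cons]; omega) (by simp) h1
        have d2 := ih ((d, Typ.form B) :: M₂) (by simp only [totalSize_cons]; omega) (by simp) h2
        refine Derivable.exch _ _ (hp'.symm.map _) ?_
        have e : sequentRoot (n, Typ.wTensor A B) =
            (Term.sum [Term.tensor c.term d.term], Typ.form (Formula.and A B)) := by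
          rw [← ht]; rfl
        rw [List.map_cons, List.map_append, e]
        exact Derivable.and _ _ _ _ _ _ d1 d2

end Forest

end ExpansionNets

theorem theorem5 {P X : Type*} (F : ExpansionNets.Forest P X)
    (hne : F ≠ []) (hF : F.IsEAnnotatedSequent) :
    F.IsExpansionNet ↔ F.ACCorrect := by
  refine ⟨fun h => ExpansionNets.Forest.acCorrect_of_noCycle (h.2.noCycle hF.linear), fun h => ⟨hF, ?_⟩⟩
  have hcyc := h.noCycle hF.toIsTyped
  obtain ⟨τ, hτ⟩ := hF.typed
  let L : List (F.Node × ExpansionNets.Typ P) := F.roots.zip (F.map Prod.snd)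
  have hlen : F.roots.length = F.length := by simp [ExpansionNets.Forest.roots]
  have hfst : L.map Prod.fst = F.roots := List.map_fst_zip (by simp [hlen])
  have hmem : L.map (fun r => (r.1.term, r.2)) = F := by
    have h1 := List.zip_map_left (f := ExpansionNets.Forest.Node.term) (l₁ := F.roots) (l₂ := F.map Prod.snd)
    rw [F.map_term_roots, List.zip_map', List.map_id'] at h1
    exact h1.symm
  have hmemF : ∀ r ∈ L, (r.1.term, r.2) ∈ F := by
    intro r hr
    have h1 := List.mem_map_of_mem (f := fun r : F.Node × ExpansionNets.Typ P => (r.1.term, r.2)) hr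
    rwa [hmem] at h1
  have hL : ExpansionNets.Forest.IsTypedList τ L := by
    refine ⟨?_, ?_, fun r hr => ?_⟩
    · rw [hfst]
      exact F.isDisjoint_roots
    · rw [hfst, F.nodesBelow_roots]
      rintro x (_ | _) a - ha
      · obtain ⟨b, hb⟩ := (hF.paired x).2 ⟨a, ha⟩
        exact ⟨b, trivial, hb⟩
      · obtain ⟨b, hb⟩ := (hF.paired x).1 ⟨a, ha⟩
        exact ⟨b, trivial, hb⟩
    · exact hτ (r.1.term, r.2) (hmemF r hr)
  have hroot : L.map ExpansionNets.Forest.sequentRoot = F := by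
    conv_rhs => rw [← hmem]
    refine List.map_congr_left fun r hr => ?_
    obtain ⟨A, hA⟩ := hF.formulas (r.1.term, r.2) (hmemF r hr)
    unfold ExpansionNets.Forest.sequentRoot
    replace hA : r.2 = ExpansionNets.Typ.form A := hA
    rw [hA]
  rw [← hroot]
  refine hL.derivable hF.linear hcyc ?_
  rintro h
  rw [h] at hroot
  exact hne hroot.symm
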